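/- Let $d\ge 1$, $s>0$, $q\ge 0$, $L>0$ and let $A f=a*f$, $(a*f)(x)=\int_{[0,1]^d}a(x-y)f(y)\,dy$, be convolution with a known real $1$-periodic filter $a\in L_2([0,1]^d)$, acting on real $1$-periodic functions in $L_2([0,1]^d)$. For $j\in\{0,1,\dots\}^d$ and $k\in K_j=\{k\in\{0,1\}^d: k_i=0 \text{ if } j_i=0\}$ let $\phi_{jk}(x)=\prod_{i:\,j_i\ne0}\sqrt2\,[(1-k_i)\cos(2\pi j_ix_i)+k_i\sin(2\pi j_ix_i)]$ be the orthonormal trigonometric basis, and let $$\mathcal F=\Big\{\sum_{j,k}\theta_{jk}\phi_{jk}:\ \sum_{j,k}a_{jk}^2\theta_{jk}^2\le L^2\Big\}.$$ Write $|j|=|j_1|+\dots+|j_d|$. Assume that, for some constants $C_0,C_1,C_2,C_3>0$, $$C_0|j|^s\le a_{jk}\le C_1|j|^s\quad (j\in\{0,1,\dots\}^d\setminus\{0\},\ k\in K_j),\qquad a_{00}>0,$$ and that the Fourier coefficients $\hat a(m)=\int_{[0,1]^d}a(x)e^{-2\pi i m\cdot x}\,dx$ of the filter satisfy $$C_2|m|^{-q}\le|\hat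 a(m)|\le C_3|m|^{-q}\quad(m\in\mathbb Z^d\setminus\{0\}),\qquad \hat a(0)\ne0.$$ Consider the Gaussian white noise model $dY_n=(Af)\,dx+n^{-1/2}dW$ on $[0,1]^d$, that is, one observes $\int h\,dY_n=\int (Af)h+n^{-1/2}\int h\,dW$ for all $h\in L_2([0,1]^d)$, where $h\mapsto\int h\,dW$ is a centered Gaussian process with covariance $\int h_1h_2$. For a finite set $\mathcal F_\delta\subset L_2([0,1]^d)$ of trigonometric polynomials, a $\delta$-net estimator over $\mathcal F_\delta$ is an estimator that minimizes $\gamma_n(g)=-2\int (Qg)\,dY_n+\|g\|_2^2$ over $g\in\mathcal F_\delta$, where $Q$ is the adjoint of the inverse of $A$, i.e. $\int (A^{-1}h)g=\int h\,(Qg)$ for $h$ in the range of $A$. For $K>0$ and $\delta>0$, call a finite $\delta$-net $\mathcal F_\delta$ of $\mathcal F$ in $L_2$ (that is, every $f\in\mathcal F$ is within $L_2$-distance $\delta$ of some element of $\mathcal F_\delta$) $K$-admissible if each element of $\mathcal F_\delta$ is a linear combination of the $\phi_{jk}$ with $\max_i j_i\le K\delta^{-1/s}$ and $\log\#\mathcal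 F_\delta\le K\delta^{-d/s}$. Then: 1. There is $K>0$ such that for all $\delta\in(0,1]$ a $K$-admissible $\delta$-net of $\mathcal F$ exists, together with a $\delta$-net estimator over it. 2. For every $K>0$, all $\delta_n$ with $c\,n^{-s/(2s+2q+d)}\le\delta_n\le C\,n^{-s/(2s+2q+d)}$ for $n\ge1$ (with constants $c,C>0$), all $K$-admissible $\delta_n$-nets and all $\delta_n$-net estimators $\hat f_n$ over them, $$\limsup_{n\to\infty}n^{2s/(2s+2q+d)}\sup_{f\in\mathcal F}E_f\|\hat f_n-f\|_2^2<\infty .$$ 3. $$\liminf_{n\to\infty}n^{2s/(2s+2q+d)}\inf_{\hat g}\sup_{f\in\mathcal F}E_f\|\hat g-f\|_2^2>0,$$ where the infimum is over all estimators $\hat g$, i.e. all measurable $L_2([0,1]^d)$-valued functions of the observation. -/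

import Mathlib

open MeasureTheory ProbabilityTheory Filter Topology
open scoped ENNReal

noncomputable section

namespace InverseProblem

/-- Lebesgue (probability) measure on the torus `(ℝ/ℤ)^d`, i.e. on `[0,1]^d` with opposite faces
identified; functions on the torus are the `1`-periodic functions. This is the measure used in
`UnitAddTorus.mFourierCoeff`. -/
abbrev torusMeasure (d : ℕ) : Measure (UnitAddTorus (Fin d)) :=
  Measure.pi fun _ => AddCircle.haarAddCircle

/-- The real Hilbert space of square integrable `1`-periodic functions. -/
abbrev L2 (d : ℕ) : Type := Lp ℝ 2 (torusMeasure d)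

/-! ### The trigonometric basis and the function class -/

/-- Indices `(j, k)` with `j ∈ {0,1,…}^d`, `k ∈ {0,1}^d` and `k i = 0` whenever `j i = 0`
(`true` codes `1`). -/
abbrev TrigIndex (d : ℕ) : Type :=
  {p : (Fin d → ℕ) × (Fin d → Bool) // ∀ i, p.1 i = 0 → p.2 i = false}

/-- The modulus `|j| = j_1 + ⋯ + j_d` of an index `(j, k)`. -/
def TrigIndex.size {d : ℕ} (p : TrigIndex d) : ℝ := ∑ i, (p.1.1 i : ℝ)

/-- One factor of a basis function: `1` if `j = 0`, otherwise `√2 cos (2 π j x)` for `k = 0` and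
`√2 sin (2 π j x)` for `k = 1` (here `fourier j x = exp (2 π i j x)`). -/
def trigFactor (j : ℕ) (k : Bool) (x : UnitAddCircle) : ℝ :=
  if j = 0 then 1
  else Real.sqrt 2 * (if k then (fourier (j : ℤ) x).im else (fourier (j : ℤ) x).re)

theorem continuous_trigFactor (j : ℕ) (k : Bool) : Continuous (trigFactor j k) := by
  unfold trigFactor
  split_ifs <;> fun_prop

/-- The basis function `φ_{jk}(x) = ∏ i, trigFactor (j i) (k i) (x i)`. -/
def trigFun {d : ℕ} (p : TrigIndex d) : C(UnitAddTorus (Fin d), ℝ) where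
  toFun x := ∏ i, trigFactor (p.1.1 i) (p.1.2 i) (x i)
  continuous_toFun := by
    refine continuous_finsetProd _ fun i _ => ?_
    exact (continuous_trigFactor _ _).comp (continuous_apply i)

/-- The basis function `φ_{jk}` as an element of `L²`. -/
def trigLp {d : ℕ} (p : TrigIndex d) : L2 d :=
  ContinuousMap.toLp (E := ℝ) 2 (torusMeasure d) ℝ (trigFun p)

/-- The ellipsoid `Θ = {θ : ∑ a_{jk}² θ_{jk}² ≤ L²}`. -/
def ellipsoid {d : ℕ} (α : TrigIndex d → ℝ) (L : ℝ) : Set (TrigIndex d → ℝ) :=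
  {θ | Summable (fun p => α p ^ 2 * θ p ^ 2) ∧ ∑' p, α p ^ 2 * θ p ^ 2 ≤ L ^ 2}

/-- The function class `ℱ = {∑ θ_{jk} φ_{jk} : θ ∈ Θ}`. -/
def ellipsoidClass {d : ℕ} (α : TrigIndex d → ℝ) (L : ℝ) : Set (L2 d) :=
  {f | ∃ θ ∈ ellipsoid α L, HasSum (fun p => θ p • trigLp p) f}

/-! ### The convolution operator and the adjoint of its inverse -/

/-- The modulus `|m| = |m_1| + ⋯ + |m_d|` of a frequency `m ∈ ℤ^d`. -/
def freqSize {d : ℕ} (m : Fin d → ℤ) : ℝ := ∑ i, |(m i : ℝ)|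

/-- Periodic convolution `(a * f)(x) = ∫ a (x - y) f y dy`. -/
def periodicConv {d : ℕ} (a f : UnitAddTorus (Fin d) → ℝ) (x : UnitAddTorus (Fin d)) : ℝ :=
  ∫ y, a (x - y) * f y ∂(torusMeasure d)

/-- `u = Q g`, where `Q` is the adjoint of the inverse of `A f = a * f`:
`∫ (A⁻¹ h) g = ∫ h u` for all `h = A f` in the range of `A`. -/
def IsAdjointInverse {d : ℕ} (a : UnitAddTorus (Fin d) → ℝ) (g u : L2 d) : Prop :=
  ∀ f : L2 d, ∫ x, f x * g x ∂(torusMeasure d) = ∫ x, periodicConv a f x * u x ∂(torusMeasure d)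

/-- The operator `Q = (A⁻¹)^*` (an arbitrary value outside its domain). If all Fourier coefficients
of `a` are nonzero, then `Q g` is unique whenever it exists, and it exists for all trigonometric
polynomials `g`. -/
def adjointInverse {d : ℕ} (a : UnitAddTorus (Fin d) → ℝ) (g : L2 d) : L2 d :=
  Classical.epsilon (IsAdjointInverse a g)

/-! ### The Gaussian white noise model -/

/-- Gaussian white noise on the torus: `W h = ∫ h dW` is a centered Gaussian process
indexed by `h ∈ L²` with covariance `E (W h₁) (W h₂) = ∫ h₁ h₂`. -/
structure IsWhiteNoise {d : ℕ} {Ω : Type*} [MeasurableSpace Ω] (P : Measure Ω)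
    (W : L2 d → Ω → ℝ) : Prop where
  measurable : ∀ h, Measurable (W h)
  gaussian : IsGaussianProcess W P
  mean : ∀ h, ∫ ω, W h ω ∂P = 0
  cov : ∀ h₁ h₂, ∫ ω, W h₁ ω * W h₂ ω ∂P = inner ℝ h₁ h₂

/-- The observation `dY_n = (A f) dx + n^{-1/2} dW`, recorded through all its integrals
`h ↦ ∫ h dY_n = ∫ (A f) h + n^{-1/2} W h`, `h ∈ L²`. -/
def observation {d : ℕ} {Ω : Type*} (a : UnitAddTorus (Fin d) → ℝ) (W : L2 d → Ω → ℝ) (n : ℕ)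
    (f : L2 d) (ω : Ω) : L2 d → ℝ :=
  fun h => ∫ x, periodicConv a f x * h x ∂(torusMeasure d) + (Real.sqrt n)⁻¹ * W h ω

/-- An estimator is an `L²`-valued measurable function of the observation; the space `L2 d → ℝ` of
observations carries the product `σ`-algebra. -/
def IsEstimator {d : ℕ} (g : (L2 d → ℝ) → L2 d) : Prop := StronglyMeasurable g

/-- The mean integrated squared error `E_f ‖g - f‖²` of the estimator `g` at sample size `n`. -/
def mise {d : ℕ} {Ω : Type*} [MeasurableSpace Ω] (P : Measure Ω)
    (a : UnitAddTorus (Fin d) → ℝ) (W : L2 d → Ω → ℝ) (n : ℕ)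
    (g : (L2 d → ℝ) → L2 d) (f : L2 d) : ℝ≥0∞ :=
  ∫⁻ ω, ‖g (observation a W n f ω) - f‖ₑ ^ 2 ∂P

/-! ### The `δ`-net estimator -/

/-- The empirical risk `γ_n(g) = -2 ∫ (Q g) dY_n + ‖g‖²` as a function of the observation `y`. -/
def empiricalRisk {d : ℕ} (a : UnitAddTorus (Fin d) → ℝ) (y : L2 d → ℝ) (g : L2 d) : ℝ :=
  -2 * y (adjointInverse a g) + ‖g‖ ^ 2

/-- `N` is a finite `δ`-net of `ℱ` that consists of trigonometric polynomials with frequencies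
`j ∈ {0,…,M}^d`, `M ≤ K δ^{-1/s}`, and satisfies the entropy bound `log #N ≤ K δ^{-d/s}`. -/
structure IsPolynomialNet {d : ℕ} (F : Set (L2 d)) (s K δ : ℝ) (N : Finset (L2 d)) : Prop where
  net : ∀ f ∈ F, ∃ g ∈ N, ‖f - g‖ ≤ δ
  support : ∀ g ∈ N,
    g ∈ Submodule.span ℝ (trigLp '' {p : TrigIndex d | ∀ i, (p.1.1 i : ℝ) ≤ K * δ ^ (-(1 / s))})
  entropy : Real.log (N.card : ℝ) ≤ K * δ ^ (-((d : ℝ) / s))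

/-- `fhat` is a `δ`-net estimator over the net `N`: it minimizes the empirical risk over `N`. -/
structure IsNetEstimator {d : ℕ} (a : UnitAddTorus (Fin d) → ℝ) (N : Finset (L2 d))
    (fhat : (L2 d → ℝ) → L2 d) : Prop where
  estimator : IsEstimator fhat
  mem : ∀ y, fhat y ∈ N
  minimizes : ∀ y, ∀ g ∈ N, empiricalRisk a y (fhat y) ≤ empiricalRisk a y g

end InverseProblem

end

/-!
The basis functions `φ_{jk}` are orthonormal, and `φ_{jk}` only has the Fourier frequencies `m`
with `|m i| = j i`. Convolution with `a` multiplies the Fourier coefficients by those of `a`, so on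
trigonometric polynomials with frequencies up to `M` the operator `Q` exists and has norm of order
`M ^ q` (`norm_adjointInverse_sub_le`, `one_le_mul_norm_fc`), while `A` maps a basis function with
`|j| ≥ M` to a function of norm at most of order `M ^ (-q)` (`norm_convLp_trigLp_le`).

*Nets.* Truncate the ellipsoid at `M ≈ δ ^ (-1 / s)` and round the remaining coefficients towards
zero to a grid of width `ε ≈ δ / √D`, where `D ≈ M ^ d` is their number. The rounded polynomials
stay in the ellipsoid, and the number of grid points in an ellipsoid is bounded by an exponential
Chebyshev inequality (`card_lattice_ellipsoid_le`). The logarithm of the bound is a sum of terms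
`log (1 + C (M / |j|) ^ (2 s))`, which is of order `M ^ d` without a logarithmic factor
(`exists_isPolynomialNet`).

*Upper bound.* Up to a constant `γ_n(g)` is `‖g - f‖² - 2 n^{-1/2} W(Q g)`. Comparing the minimizer
with a net element close to `f` leaves the noise increment `W(Q g) - W(Q g₀)`, a centered Gaussian
variable with standard deviation at most `κ ‖g - g₀‖`. Young's inequality absorbs `‖g - g₀‖`, and
the exponential moments of the standardized squares bound their maximum over the net by `log #N`.
Hence the risk is of order `δ² + κ² log #N / n` with `κ ≈ δ ^ (-q / s)`
(`mise_le_of_isNetEstimator`), and the choice of `δ_n` balances the two terms.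

*Lower bound.* Shifting the white noise by `⟪u, ·⟫` multiplies its law by the density
`exp (W u - ‖u‖² / 2)` (`IsWhiteNoise.map_add_inner`), because the moment generating functions of
all finite linear combinations agree. This gives a two point bound (`two_point_bound`) and from it
Assouad's lemma (`assouad_bound`), which is applied to the largest cube in the ellipsoid spanned by
the cosines with frequencies in `[M, 2M)^d`, where `M ≈ n ^ (1 / (2s + 2q + d))`
(`liminf_mise_pos`).
-/

noncomputable section

namespace InverseProblem

/-! ### Fourier coefficients and convolution -/

section

variable {d : ℕ}

/-- The Fourier coefficient `∫ f(x) e^{-2πi m·x} dx` of a real function on the torus. -/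
def fc (f : UnitAddTorus (Fin d) → ℝ) (m : Fin d → ℤ) : ℂ :=
  UnitAddTorus.mFourierCoeff (fun x => (f x : ℂ)) m

theorem fc_eq (f : UnitAddTorus (Fin d) → ℝ) (m : Fin d → ℤ) :
    fc f m = ∫ x, UnitAddTorus.mFourier (-m) x * (f x : ℂ) ∂(torusMeasure d) := rfl

theorem fc_congr {f g : UnitAddTorus (Fin d) → ℝ} (h : f =ᵐ[torusMeasure d] g) (m : Fin d → ℤ) :
    fc f m = fc g m := by
  rw [fc_eq, fc_eq]
  refine integral_congr_ae ?_
  filter_upwards [h] with x hx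
  rw [hx]

/-- Parseval's identity for real square integrable functions. -/
theorem hasSum_conj_fc_mul_fc {f g : UnitAddTorus (Fin d) → ℝ}
    (hf : MemLp f 2 (torusMeasure d)) (hg : MemLp g 2 (torusMeasure d)) :
    HasSum (fun m => (starRingEnd ℂ) (fc f m) * fc g m)
      ((∫ x, f x * g x ∂(torusMeasure d) : ℝ) : ℂ) := by
  have hf' : MemLp (fun x => (f x : ℂ)) 2 (torusMeasure d) := hf.ofReal
  have hg' : MemLp (fun x => (g x : ℂ)) 2 (torusMeasure d) := hg.ofReal
  have key := UnitAddTorus.hasSum_prod_mFourierCoeff (d := Fin d) (hf'.toLp _) (hg'.toLp _)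
  have h1 := hf'.coeFn_toLp
  have h2 := hg'.coeFn_toLp
  have e1 (m : Fin d → ℤ) : UnitAddTorus.mFourierCoeff (hf'.toLp _) m = fc f m := by
    refine integral_congr_ae ?_
    filter_upwards [h1] with x hx
    rw [hx]
  have e2 (m : Fin d → ℤ) : UnitAddTorus.mFourierCoeff (hg'.toLp _) m = fc g m := by
    refine integral_congr_ae ?_
    filter_upwards [h2] with x hx
    rw [hx]
  simp only [e1, e2] at key
  convert! key using 1
  rw [← integral_complex_ofReal]
  refine integral_congr_ae ?_
  filter_upwards [h1, h2] with x hx hy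
  rw [hx, hy]
  simp

theorem hasSum_norm_fc_sq {f : UnitAddTorus (Fin d) → ℝ} (hf : MemLp f 2 (torusMeasure d)) :
    HasSum (fun m => ‖fc f m‖ ^ 2) (∫ x, f x ^ 2 ∂(torusMeasure d)) := by
  have h := hasSum_conj_fc_mul_fc hf hf
  have h2 := Complex.hasSum_re h
  simp only [Complex.ofReal_re] at h2
  convert! h2 using 1
  · ext m
    rw [← Complex.normSq_eq_conj_mul_self, Complex.ofReal_re, Complex.normSq_eq_norm_sq]
  · simp only [pow_two]

theorem norm_sq_eq_integral (g : L2 d) : ‖g‖ ^ 2 = ∫ x, g x ^ 2 ∂(torusMeasure d) := by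
  rw [← real_inner_self_eq_norm_sq, L2.inner_def]
  simp [pow_two]

theorem hasSum_norm_fc_sq_L2 (g : L2 d) : HasSum (fun m => ‖fc g m‖ ^ 2) (‖g‖ ^ 2) := by
  rw [norm_sq_eq_integral]
  exact hasSum_norm_fc_sq (Lp.memLp g)

theorem inner_eq_integral (f g : L2 d) :
    inner ℝ f g = ∫ x, f x * g x ∂(torusMeasure d) := by
  rw [L2.inner_def]
  simp [mul_comm]

theorem norm_mFourier_apply (m : Fin d → ℤ) (x : UnitAddTorus (Fin d)) :
    ‖UnitAddTorus.mFourier m x‖ = 1 := by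
  simp only [UnitAddTorus.mFourier, fourier_apply, ContinuousMap.coe_mk, norm_prod,
    Circle.norm_coe, Finset.prod_const_one]

theorem mFourier_add_apply (m : Fin d → ℤ) (x y : UnitAddTorus (Fin d)) :
    UnitAddTorus.mFourier m (x + y) = UnitAddTorus.mFourier m x * UnitAddTorus.mFourier m y := by
  simp [UnitAddTorus.mFourier, fourier_apply, smul_add, AddCircle.toCircle_add,
    Finset.prod_mul_distrib]

theorem mFourier_apply_neg (m : Fin d → ℤ) (x : UnitAddTorus (Fin d)) :
    UnitAddTorus.mFourier m (-x) = UnitAddTorus.mFourier (-m) x := by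
  simp [UnitAddTorus.mFourier, fourier_apply, AddCircle.toCircle_neg]

theorem integrable_mFourier_mul {f : UnitAddTorus (Fin d) → ℝ}
    (hf : Integrable f (torusMeasure d)) (m : Fin d → ℤ) :
    Integrable (fun x => UnitAddTorus.mFourier m x * (f x : ℂ)) (torusMeasure d) := by
  refine (hf.ofReal (𝕜 := ℂ)).bdd_mul (c := 1) (map_continuous _).aestronglyMeasurable ?_
  exact Eventually.of_forall fun x => (norm_mFourier_apply m x).le

/-- The convolution theorem: Fubini applied to the convolution of the functions multiplied by the
character. -/
theorem fc_periodicConv {a f : UnitAddTorus (Fin d) → ℝ}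
    (ha : Integrable a (torusMeasure d)) (hf : Integrable f (torusMeasure d)) (m : Fin d → ℤ) :
    fc (periodicConv a f) m = fc a m * fc f m := by
  have h := integral_convolution (μ := torusMeasure d) (ν := torusMeasure d)
    (ContinuousLinearMap.mul ℝ ℂ) (integrable_mFourier_mul hf (-m))
      (integrable_mFourier_mul ha (-m))
  rw [fc_eq, fc_eq a, fc_eq f, mul_comm (∫ x, _ ∂_)]
  refine Eq.trans ?_ h
  congr 1
  ext x
  rw [convolution_def, periodicConv, ← integral_complex_ofReal, ← integral_const_mul]
  congr 1
  ext y
  have : UnitAddTorus.mFourier (-m) x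
      = UnitAddTorus.mFourier (-m) y * UnitAddTorus.mFourier (-m) (x - y) := by
    rw [← mFourier_add_apply, add_sub_cancel]
  simp only [ContinuousLinearMap.mul_apply']
  rw [this]
  push_cast
  ring

instance isNegInvariant_haarAddCircle :
    (AddCircle.haarAddCircle (T := 1)).IsNegInvariant := inferInstance

instance isNegInvariant_torusMeasure : (torusMeasure d).IsNegInvariant :=
  inferInstanceAs (Measure.pi fun _ => AddCircle.haarAddCircle).IsNegInvariant

theorem fc_comp_neg (a : UnitAddTorus (Fin d) → ℝ) (m : Fin d → ℤ) :
    fc (fun x => a (-x)) m = (starRingEnd ℂ) (fc a m) := by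
  rw [fc_eq, fc_eq, ← integral_conj,
    ← integral_neg_eq_self (fun x => UnitAddTorus.mFourier (-m) x * ((a (-x) : ℝ) : ℂ))]
  congr 1
  ext x
  simp [mFourier_apply_neg, ← UnitAddTorus.mFourier_neg]

/-- Young's inequality bounds the convolution of two square integrable functions pointwise, as the
measure is invariant under `y ↦ x - y`. -/
theorem memLp_periodicConv {a f : UnitAddTorus (Fin d) → ℝ}
    (ha : MemLp a 2 (torusMeasure d)) (hf : MemLp f 2 (torusMeasure d)) :
    MemLp (periodicConv a f) 2 (torusMeasure d) := by
  have hmeas : AEStronglyMeasurable (periodicConv a f) (torusMeasure d) := by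
    have := (hf.1.convolution_integrand (ContinuousLinearMap.mul ℝ ℝ) (μ := torusMeasure d)
      ha.1).integral_prod_right'
    refine this.congr (Eventually.of_forall fun x => ?_)
    simp [periodicConv, mul_comm]
  refine MemLp.of_bound hmeas
    ((∫ x, a x ^ 2 ∂(torusMeasure d)) + ∫ x, f x ^ 2 ∂(torusMeasure d))
    (Eventually.of_forall fun x => ?_)
  have ha2 : Integrable (fun y => a (x - y) ^ 2) (torusMeasure d) :=
    ha.integrable_sq.comp_sub_left x
  have hf2 := hf.integrable_sq
  rw [← integral_sub_left_eq_self (fun y => a y ^ 2) (torusMeasure d) x,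
    ← integral_add ha2 hf2]
  refine norm_integral_le_of_norm_le (ha2.add hf2) (Eventually.of_forall fun y => ?_)
  rw [Real.norm_eq_abs, abs_le]
  constructor <;> nlinarith [sq_nonneg (a (x - y) + f y), sq_nonneg (a (x - y) - f y),
    sq_nonneg (a (x - y)), sq_nonneg (f y)]

theorem memLp_comp_neg {a : UnitAddTorus (Fin d) → ℝ} (ha : MemLp a 2 (torusMeasure d)) :
    MemLp (fun x => a (-x)) 2 (torusMeasure d) :=
  ha.comp_measurePreserving (Measure.measurePreserving_neg (torusMeasure d))

theorem fc_add {f g : UnitAddTorus (Fin d) → ℝ} (hf : Integrable f (torusMeasure d))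
    (hg : Integrable g (torusMeasure d)) (m : Fin d → ℤ) :
    fc (fun x => f x + g x) m = fc f m + fc g m := by
  rw [fc_eq, fc_eq, fc_eq,
    ← integral_add (integrable_mFourier_mul hf _) (integrable_mFourier_mul hg _)]
  congr 1
  ext x
  push_cast
  ring

theorem fc_const_mul (c : ℝ) (f : UnitAddTorus (Fin d) → ℝ) (m : Fin d → ℤ) :
    fc (fun x => c * f x) m = c * fc f m := by
  rw [fc_eq, fc_eq, ← integral_const_mul]
  congr 1
  ext x
  push_cast
  ring

/-- The Fourier coefficients of an element of `L²`, as a linear map into sequences. -/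
def fcLin (d : ℕ) : L2 d →ₗ[ℝ] (Fin d → ℤ) → ℂ where
  toFun g m := fc g m
  map_add' f g := by
    ext m
    rw [fc_congr (Lp.coeFn_add f g)]
    exact fc_add ((Lp.memLp f).integrable one_le_two) ((Lp.memLp g).integrable one_le_two) m
  map_smul' c f := by
    ext m
    rw [fc_congr (Lp.coeFn_smul c f)]
    exact fc_const_mul c f m

theorem fcLin_apply (g : L2 d) (m : Fin d → ℤ) : fcLin d g m = fc g m := rfl

theorem fcLin_injective : Function.Injective (fcLin d) := by
  rw [← LinearMap.ker_eq_bot, LinearMap.ker_eq_bot']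
  intro g hg
  have h := hasSum_norm_fc_sq_L2 g
  have h0 (m : Fin d → ℤ) : fc g m = 0 := by rw [← fcLin_apply, hg]; rfl
  simp only [h0, norm_zero, ne_eq, OfNat.ofNat_ne_zero, not_false_eq_true, zero_pow] at h
  have := h.unique hasSum_zero
  simpa using this

/-- Convolution with `a`, as a function `L² → L²`. -/
def convLp (a : UnitAddTorus (Fin d) → ℝ) (ha : MemLp a 2 (torusMeasure d)) (f : L2 d) : L2 d :=
  (memLp_periodicConv ha (Lp.memLp f)).toLp _

theorem fc_convLp {a : UnitAddTorus (Fin d) → ℝ} (ha : MemLp a 2 (torusMeasure d)) (f : L2 d)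
    (m : Fin d → ℤ) : fc (convLp a ha f) m = fc a m * fc f m := by
  rw [convLp, fc_congr (MemLp.coeFn_toLp _),
    fc_periodicConv (ha.integrable one_le_two) ((Lp.memLp f).integrable one_le_two)]

theorem integral_periodicConv_mul {a : UnitAddTorus (Fin d) → ℝ} (ha : MemLp a 2 (torusMeasure d))
    (f h : L2 d) :
    ∫ x, periodicConv a f x * h x ∂(torusMeasure d) = inner ℝ (convLp a ha f) h := by
  rw [inner_eq_integral]
  refine integral_congr_ae ?_
  filter_upwards [(memLp_periodicConv ha (Lp.memLp f)).coeFn_toLp] with x hx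
  rw [convLp, hx]

/-- Convolution with `a`, as a linear map. -/
def convLin (a : UnitAddTorus (Fin d) → ℝ) (ha : MemLp a 2 (torusMeasure d)) : L2 d →ₗ[ℝ] L2 d where
  toFun := convLp a ha
  map_add' f g := by
    apply fcLin_injective
    rw [map_add]
    ext m
    rw [Pi.add_apply, fcLin_apply, fcLin_apply, fcLin_apply, fc_convLp, fc_convLp, fc_convLp,
      ← fcLin_apply (f + g), map_add, Pi.add_apply, fcLin_apply, fcLin_apply, mul_add]
  map_smul' c f := by
    apply fcLin_injective
    rw [map_smul]
    ext m
    rw [Pi.smul_apply, fcLin_apply, fcLin_apply, fc_convLp, fc_convLp,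
      ← fcLin_apply (c • f), map_smul, Pi.smul_apply, fcLin_apply, mul_smul_comm]
    rfl

theorem convLin_apply {a : UnitAddTorus (Fin d) → ℝ} (ha : MemLp a 2 (torusMeasure d)) (f : L2 d) :
    convLin a ha f = convLp a ha f := rfl

/-- The adjoint of convolution with `a` is convolution with the reflected filter `x ↦ a (-x)`. -/
theorem inner_convLp_left {a : UnitAddTorus (Fin d) → ℝ} (ha : MemLp a 2 (torusMeasure d))
    (f u : L2 d) :
    inner ℝ (convLp a ha f) u = inner ℝ f (convLp _ (memLp_comp_neg ha) u) := by
  have h1 := hasSum_conj_fc_mul_fc (Lp.memLp (convLp a ha f)) (Lp.memLp u)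
  have h2 := hasSum_conj_fc_mul_fc (Lp.memLp f) (Lp.memLp (convLp _ (memLp_comp_neg ha) u))
  rw [← inner_eq_integral] at h1 h2
  have : (fun m => (starRingEnd ℂ) (fc (convLp a ha f) m) * fc u m) = fun m =>
      (starRingEnd ℂ) (fc f m) * fc (convLp _ (memLp_comp_neg ha) u) m := by
    ext m
    rw [fc_convLp, fc_convLp, fc_comp_neg, map_mul]
    ring
  rw [this] at h1
  exact_mod_cast h1.unique h2

/-- `Q g` is the solution `u` of the deconvolution problem with the reflected filter. -/
theorem isAdjointInverse_iff {a : UnitAddTorus (Fin d) → ℝ} (ha : MemLp a 2 (torusMeasure d))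
    (g u : L2 d) : IsAdjointInverse a g u ↔ convLp _ (memLp_comp_neg ha) u = g := by
  have : IsAdjointInverse a g u ↔
      ∀ f : L2 d, inner ℝ f g = inner ℝ f (convLp _ (memLp_comp_neg ha) u) := by
    unfold IsAdjointInverse
    simp only [integral_periodicConv_mul ha, ← inner_eq_integral, inner_convLp_left]
  rw [this]
  constructor
  · exact fun h => (ext_inner_left ℝ h).symm
  · rintro rfl f
    rfl

end

/-! ### The trigonometric basis -/

section

variable {d : ℕ}

theorem integral_fourier (n : ℤ) :
    ∫ x : UnitAddCircle, fourier n x ∂AddCircle.haarAddCircle = if n = 0 then 1 else 0 := by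
  split_ifs with h
  · subst h
    simp
  · have := integral_eq_zero_of_add_right_eq_neg (μ := AddCircle.haarAddCircle)
      (fourier_add_half_inv_index h (by norm_num : (0 : ℝ) < 1))
    exact this

theorem continuous_fourier (n : ℤ) : Continuous (fourier n : UnitAddCircle → ℂ) :=
  map_continuous _

theorem integrable_of_continuous {E : Type*} [NormedAddCommGroup E] {f : UnitAddCircle → E}
    (hf : Continuous f) : Integrable f AddCircle.haarAddCircle :=
  hf.integrable_of_hasCompactSupport (HasCompactSupport.of_compactSpace f)

theorem integral_fourier_re (n : ℤ) :
    ∫ x : UnitAddCircle, (fourier n x).re ∂AddCircle.haarAddCircle = if n = 0 then 1 else 0 := by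
  have h := integral_re (𝕜 := ℂ) (integrable_of_continuous (continuous_fourier n))
  simp only [RCLike.re_to_complex] at h
  rw [h, integral_fourier]
  split_ifs <;> simp

theorem integral_fourier_im (n : ℤ) :
    ∫ x : UnitAddCircle, (fourier n x).im ∂AddCircle.haarAddCircle = 0 := by
  have h := integral_im (𝕜 := ℂ) (integrable_of_continuous (continuous_fourier n))
  simp only [RCLike.im_to_complex] at h
  rw [h, integral_fourier]
  split_ifs <;> simp

theorem integral_trigFactor {j : ℕ} (hj : j ≠ 0) (k : Bool) :
    ∫ x, trigFactor j k x ∂AddCircle.haarAddCircle = 0 := by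
  cases k
  · simp only [trigFactor, hj, if_false, Bool.false_eq_true]
    rw [integral_const_mul, integral_fourier_re, if_neg (by omega), mul_zero]
  · simp only [trigFactor, hj, if_false, if_true]
    rw [integral_const_mul, integral_fourier_im, mul_zero]

theorem trigFactor_zero (k : Bool) (x : UnitAddCircle) : trigFactor 0 k x = 1 := if_pos rfl

theorem integral_trigFactor_mul {j j' : ℕ} {k k' : Bool} (h : j = 0 → k = false)
    (h' : j' = 0 → k' = false) :
    ∫ x, trigFactor j k x * trigFactor j' k' x ∂AddCircle.haarAddCircle
      = if j = j' ∧ k = k' then 1 else 0 := by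
  have iR (n : ℤ) : Integrable (fun x : UnitAddCircle => (fourier n x).re)
      AddCircle.haarAddCircle :=
    integrable_of_continuous (Complex.continuous_re.comp (continuous_fourier n))
  have iI (n : ℤ) : Integrable (fun x : UnitAddCircle => (fourier n x).im)
      AddCircle.haarAddCircle :=
    integrable_of_continuous (Complex.continuous_im.comp (continuous_fourier n))
  have s2 : √2 * √2 = (2 : ℝ) := Real.mul_self_sqrt (by norm_num)
  have add (x : UnitAddCircle) : (fourier ((j : ℤ) + j') x : ℂ)
      = fourier (j : ℤ) x * fourier (j' : ℤ) x :=
    fourier_add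
  have sub (x : UnitAddCircle) : (fourier ((j : ℤ) - j') x : ℂ)
      = fourier (j : ℤ) x * (starRingEnd ℂ) (fourier (j' : ℤ) x) := by
    rw [sub_eq_add_neg, fourier_add, fourier_neg]
  have z0 : ((j : ℤ) + j' = 0) ↔ (j = 0 ∧ j' = 0) := by omega
  have z1 : ((j : ℤ) - j' = 0) ↔ j = j' := by omega
  by_cases hj : j = 0
  · rw [h hj]
    subst hj
    by_cases hj' : j' = 0
    · rw [h' hj']
      subst hj'
      simp [trigFactor_zero]
    · simp only [trigFactor_zero, one_mul]
      rw [integral_trigFactor hj', if_neg fun h => hj' h.1.symm]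
  · by_cases hj' : j' = 0
    · rw [h' hj']
      subst hj'
      simp only [trigFactor_zero, mul_one]
      rw [integral_trigFactor hj, if_neg fun h => hj h.1]
    · cases k <;> cases k'
      · have e : ∀ x, trigFactor j false x * trigFactor j' false x
            = (fourier ((j : ℤ) + j') x).re + (fourier ((j : ℤ) - j') x).re := by
          intro x
          rw [add, sub]
          simp only [trigFactor, hj, hj', if_false, Complex.mul_re, Complex.conj_re,
            Complex.conj_im, Bool.false_eq_true]
          linear_combination (fourier (j : ℤ) x).re * (fourier (j' : ℤ) x).re * s2
        simp only [e]
        rw [integral_add (iR _) (iR _), integral_fourier_re, integral_fourier_re]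
        simp [z0, z1, hj]
      · have e : ∀ x, trigFactor j false x * trigFactor j' true x
            = (fourier ((j : ℤ) + j') x).im - (fourier ((j : ℤ) - j') x).im := by
          intro x
          rw [add, sub]
          simp only [trigFactor, hj, hj', if_false, if_true, Complex.mul_im, Complex.conj_re,
            Complex.conj_im, Bool.false_eq_true]
          linear_combination (fourier (j : ℤ) x).re * (fourier (j' : ℤ) x).im * s2
        simp only [e]
        rw [integral_sub (iI _) (iI _), integral_fourier_im, integral_fourier_im]
        simp
      · have e : ∀ x, trigFactor j true x * trigFactor j' false x
            = (fourier ((j : ℤ) + j') x).im + (fourier ((j : ℤ) - j') x).im := by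
          intro x
          rw [add, sub]
          simp only [trigFactor, hj, hj', if_false, if_true, Complex.mul_im, Complex.conj_re,
            Complex.conj_im, Bool.false_eq_true]
          linear_combination (fourier (j : ℤ) x).im * (fourier (j' : ℤ) x).re * s2
        simp only [e]
        rw [integral_add (iI _) (iI _), integral_fourier_im, integral_fourier_im]
        simp
      · have e : ∀ x, trigFactor j true x * trigFactor j' true x
            = (fourier ((j : ℤ) - j') x).re - (fourier ((j : ℤ) + j') x).re := by
          intro x
          rw [add, sub]
          simp only [trigFactor, hj, hj', if_false, if_true, Complex.mul_re, Complex.conj_re,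
            Complex.conj_im]
          linear_combination (fourier (j : ℤ) x).im * (fourier (j' : ℤ) x).im * s2
        simp only [e]
        rw [integral_sub (iR _) (iR _), integral_fourier_re, integral_fourier_re]
        simp [z0, z1, hj]

/-- A factor of frequency `j` only has the Fourier frequencies `±j`. -/
theorem integral_fourier_mul_trigFactor {j : ℕ} {m : ℤ} (k : Bool) (h : m.natAbs ≠ j) :
    ∫ x : UnitAddCircle, fourier (-m) x * (trigFactor j k x : ℂ) ∂AddCircle.haarAddCircle = 0 := by
  obtain ⟨c₁, c₂, hc⟩ : ∃ c₁ c₂ : ℂ, ∀ x : UnitAddCircle,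
      (trigFactor j k x : ℂ) = c₁ * fourier (j : ℤ) x + c₂ * fourier (-(j : ℤ)) x := by
    by_cases hj : j = 0
    · exact ⟨1, 0, fun x => by subst hj; simp [trigFactor]⟩
    · cases k
      · refine ⟨√2 / 2, √2 / 2, fun x => ?_⟩
        simp only [trigFactor, hj, if_false, Bool.false_eq_true]
        rw [Complex.ofReal_mul, Complex.re_eq_add_conj, fourier_neg]
        ring
      · refine ⟨√2 / (2 * Complex.I), -√2 / (2 * Complex.I), fun x => ?_⟩
        simp only [trigFactor, hj, if_false, if_true]
        rw [Complex.ofReal_mul, Complex.im_eq_sub_conj, fourier_neg]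
        ring
  have e (x : UnitAddCircle) : (fourier (-m) x : ℂ) * (trigFactor j k x : ℂ)
      = c₁ * fourier (-m + j) x + c₂ * fourier (-m + -(j : ℤ)) x := by
    rw [hc, fourier_add, fourier_add]
    ring
  simp only [e]
  rw [integral_add ((integrable_of_continuous (continuous_fourier _)).const_mul _)
    ((integrable_of_continuous (continuous_fourier _)).const_mul _), integral_const_mul,
    integral_const_mul, integral_fourier, integral_fourier, if_neg (by omega), if_neg (by omega)]
  simp

theorem coeFn_trigLp (p : TrigIndex d) : trigLp p =ᵐ[torusMeasure d] trigFun p :=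
  ContinuousMap.coeFn_toLp _ _

/-- The basis function `φ_{jk}` only has Fourier frequencies `m` with `|m i| = j i` for all `i`. -/
theorem fc_trigLp_eq_zero {p : TrigIndex d} {m : Fin d → ℤ} {i : Fin d}
    (h : (m i).natAbs ≠ p.1.1 i) : fc (trigLp p) m = 0 := by
  rw [fc_congr (coeFn_trigLp p), fc_eq]
  have e (x : UnitAddTorus (Fin d)) : UnitAddTorus.mFourier (-m) x * (trigFun p x : ℂ)
      = ∏ i, (fourier (-m i) (x i) * (trigFactor (p.1.1 i) (p.1.2 i) (x i) : ℂ)) := by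
    simp [UnitAddTorus.mFourier, trigFun, Finset.prod_mul_distrib]
  simp only [e]
  have := integral_fintype_prod_eq_prod (𝕜 := ℂ)
    (μ := fun _ : Fin d => AddCircle.haarAddCircle (T := 1))
    (fun i (x : UnitAddCircle) => fourier (-m i) x * (trigFactor (p.1.1 i) (p.1.2 i) x : ℂ))
  refine this.trans ?_
  exact Finset.prod_eq_zero (Finset.mem_univ i) (integral_fourier_mul_trigFactor _ h)

theorem orthonormal_trigLp : Orthonormal ℝ (trigLp (d := d)) := by
  classical
  rw [orthonormal_iff_ite]
  intro p p'
  rw [inner_eq_integral]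
  have e : (fun x => trigLp p x * trigLp p' x) =ᵐ[torusMeasure d] fun x =>
      ∏ i, (trigFactor (p.1.1 i) (p.1.2 i) (x i) * trigFactor (p'.1.1 i) (p'.1.2 i) (x i)) := by
    filter_upwards [coeFn_trigLp p, coeFn_trigLp p'] with x h h'
    rw [h, h']
    simp [trigFun, Finset.prod_mul_distrib]
  rw [integral_congr_ae e]
  have := integral_fintype_prod_eq_prod (𝕜 := ℝ)
    (μ := fun _ : Fin d => AddCircle.haarAddCircle (T := 1))
    (fun i (x : UnitAddCircle) =>
      trigFactor (p.1.1 i) (p.1.2 i) x * trigFactor (p'.1.1 i) (p'.1.2 i) x)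
  refine this.trans ?_
  simp only [integral_trigFactor_mul (p.2 _) (p'.2 _)]
  rw [Finset.prod_ite_zero]
  simp only [Finset.prod_const_one]
  congr 1
  simp only [Finset.mem_univ, true_implies, forall_and, Subtype.ext_iff, Prod.ext_iff,
    funext_iff]

/-! ### The adjoint of the inverse on trigonometric polynomials -/

/-- The functions whose Fourier frequencies lie in the set `B`. -/
def bandlimited (B : Set (Fin d → ℤ)) : Submodule ℝ (L2 d) where
  carrier := {g | ∀ m ∉ B, fc g m = 0}
  add_mem' {f g} hf hg m hm := by
    rw [← fcLin_apply, map_add, Pi.add_apply, fcLin_apply, fcLin_apply, hf m hm, hg m hm, add_zero]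
  zero_mem' m _ := by
    rw [← fcLin_apply, map_zero, Pi.zero_apply]
  smul_mem' c g hg m hm := by
    rw [← fcLin_apply, map_smul, Pi.smul_apply, fcLin_apply, hg m hm, smul_zero]

theorem finiteDimensional_bandlimited {B : Set (Fin d → ℤ)} (hB : B.Finite) :
    FiniteDimensional ℝ (bandlimited B) := by
  have := hB.fintype
  let φ : bandlimited B →ₗ[ℝ] (B → ℂ) :=
    (LinearMap.funLeft ℝ ℂ (Subtype.val : B → (Fin d → ℤ))) ∘ₗ fcLin d ∘ₗ (bandlimited B).subtype
  refine FiniteDimensional.of_injective φ fun f g h => Subtype.ext (fcLin_injective ?_)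
  ext m
  by_cases hm : m ∈ B
  · exact congrFun h ⟨m, hm⟩
  · rw [fcLin_apply, fcLin_apply, f.2 m hm, g.2 m hm]

/-- Deconvolution of a band limited function: on the finite dimensional space of functions with
frequencies in `B` the convolution is injective, hence surjective. -/
theorem exists_convLp_eq {b : UnitAddTorus (Fin d) → ℝ} (hb : MemLp b 2 (torusMeasure d))
    (hb0 : ∀ m, fc b m ≠ 0) {B : Set (Fin d → ℤ)} (hB : B.Finite) {g : L2 d}
    (hg : g ∈ bandlimited B) : ∃ u, convLp b hb u = g := by
  have := finiteDimensional_bandlimited hB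
  let T : bandlimited B →ₗ[ℝ] bandlimited B := (convLin b hb).restrict fun f hf m hm => by
    rw [convLin_apply, fc_convLp, hf m hm, mul_zero]
  have hT : Function.Injective T := by
    intro f f' h
    refine Subtype.ext (fcLin_injective ?_)
    ext m
    have h1 : convLp b hb f = convLp b hb f' := congrArg Subtype.val h
    have h2 : fc (convLp b hb f) m = fc (convLp b hb f') m := by rw [h1]
    rw [fc_convLp, fc_convLp] at h2
    exact mul_left_cancel₀ (hb0 m) h2
  obtain ⟨u, hu⟩ := (LinearMap.injective_iff_surjective.1 hT) ⟨g, hg⟩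
  exact ⟨u, congrArg Subtype.val hu⟩

theorem isAdjointInverse_adjointInverse {a : UnitAddTorus (Fin d) → ℝ}
    (ha : MemLp a 2 (torusMeasure d)) (ha0 : ∀ m, fc a m ≠ 0) {B : Set (Fin d → ℤ)}
    (hB : B.Finite) {g : L2 d} (hg : g ∈ bandlimited B) :
    IsAdjointInverse a g (adjointInverse a g) := by
  obtain ⟨u, hu⟩ := exists_convLp_eq (memLp_comp_neg ha)
    (fun m => by rw [fc_comp_neg]; exact (map_ne_zero _).2 (ha0 m)) hB hg
  exact Classical.epsilon_spec (p := IsAdjointInverse a g) ⟨u, (isAdjointInverse_iff ha g u).2 hu⟩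

theorem norm_convLp_le {a : UnitAddTorus (Fin d) → ℝ} (ha : MemLp a 2 (torusMeasure d))
    {B : Set (Fin d → ℤ)} {κ : ℝ} (hκ : 0 ≤ κ) (h : ∀ m ∈ B, ‖fc a m‖ ≤ κ) {g : L2 d}
    (hg : g ∈ bandlimited B) : ‖convLp a ha g‖ ≤ κ * ‖g‖ := by
  refine abs_le_of_sq_le_sq' ?_ (by positivity) |>.2
  rw [mul_pow]
  refine hasSum_le (fun m => ?_) (hasSum_norm_fc_sq_L2 _) ((hasSum_norm_fc_sq_L2 g).mul_left _)
  rw [fc_convLp, norm_mul, mul_pow]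
  by_cases hm : m ∈ B
  · gcongr
    exact h m hm
  · rw [hg m hm]
    simp

/-- `Q` is bounded by the inverse of the smallest Fourier coefficient of the filter on the band. -/
theorem norm_adjointInverse_sub_le {a : UnitAddTorus (Fin d) → ℝ}
    (ha : MemLp a 2 (torusMeasure d)) (ha0 : ∀ m, fc a m ≠ 0) {B : Set (Fin d → ℤ)}
    (hB : B.Finite) {κ : ℝ} (hκ : 0 ≤ κ) (h : ∀ m ∈ B, 1 ≤ κ * ‖fc a m‖) {g g' : L2 d}
    (hg : g ∈ bandlimited B) (hg' : g' ∈ bandlimited B) :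
    ‖adjointInverse a g - adjointInverse a g'‖ ≤ κ * ‖g - g'‖ := by
  have h1 := (isAdjointInverse_iff ha g _).1 (isAdjointInverse_adjointInverse ha ha0 hB hg)
  have h2 := (isAdjointInverse_iff ha g' _).1 (isAdjointInverse_adjointInverse ha ha0 hB hg')
  set u := adjointInverse a g
  set u' := adjointInverse a g'
  have h3 : convLp _ (memLp_comp_neg ha) (u - u') = g - g' := by
    rw [← convLin_apply, map_sub, convLin_apply, convLin_apply, h1, h2]
  have hgg := (bandlimited B).sub_mem hg hg'
  refine abs_le_of_sq_le_sq' ?_ (by positivity) |>.2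
  rw [mul_pow]
  refine hasSum_le (fun m => ?_) (hasSum_norm_fc_sq_L2 _) ((hasSum_norm_fc_sq_L2 _).mul_left _)
  have e : fc (g - g') m = (starRingEnd ℂ) (fc a m) * fc (u - u') m := by
    rw [← h3, fc_convLp, fc_comp_neg]
  by_cases hm : m ∈ B
  · rw [e, norm_mul, RCLike.norm_conj, ← mul_pow, ← mul_assoc]
    gcongr
    exact le_mul_of_one_le_left (norm_nonneg _) (h m hm)
  · have h4 : fc (u - u') m = 0 := by
      have h5 := hgg m hm
      rw [e] at h5
      exact (mul_eq_zero.1 h5).resolve_left ((map_ne_zero _).2 (ha0 m))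
    rw [h4, norm_zero, zero_pow two_ne_zero]
    positivity

end

/-! ### White noise and the Cameron–Martin formula -/

section

variable {d : ℕ} {Ω : Type*} [MeasurableSpace Ω] {P : Measure Ω} {W : L2 d → Ω → ℝ}

/-- The likelihood ratio `exp (W u - ‖u‖² / 2)` of the white noise shifted by `u`. -/
def likelihood (W : L2 d → Ω → ℝ) (u : L2 d) (ω : Ω) : ℝ :=
  Real.exp (W u ω - ‖u‖ ^ 2 / 2)

namespace IsWhiteNoise

theorem memLp_two (hW : IsWhiteNoise P W) (h : L2 d) : MemLp (W h) 2 P :=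
  (hW.gaussian.hasGaussianLaw_eval h).memLp_two

theorem integrable_mul (hW : IsWhiteNoise P W) (x y : L2 d) :
    Integrable (fun ω => W x ω * W y ω) P :=
  (hW.memLp_two x).integrable_mul (hW.memLp_two y)

/-- White noise is almost surely linear: `W (x + c y) - W x - c W y` has variance `0`. -/
theorem add_smul_ae (hW : IsWhiteNoise P W) (x y : L2 d) (c : ℝ) :
    W (x + c • y) =ᵐ[P] fun ω => W x ω + c * W y ω := by
  set z := x + c • y with hz
  have i (u v : L2 d) := hW.integrable_mul u v
  have hsq : ∀ ω, (W z ω - (W x ω + c * W y ω)) ^ 2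
      = (W z ω * W z ω + W x ω * W x ω + c ^ 2 * (W y ω * W y ω))
        - (2 * (W z ω * W x ω) + 2 * c * (W z ω * W y ω) - 2 * c * (W x ω * W y ω)) := by
    intro ω
    ring
  have i0 : Integrable (fun ω => W z ω * W z ω + W x ω * W x ω) P := (i z z).add (i x x)
  have i1 : Integrable (fun ω => W z ω * W z ω + W x ω * W x ω + c ^ 2 * (W y ω * W y ω)) P :=
    i0.add ((i y y).const_mul _)
  have i2 : Integrable (fun ω => 2 * (W z ω * W x ω) + 2 * c * (W z ω * W y ω)) P :=
    ((i z x).const_mul _).add ((i z y).const_mul _)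
  have i3 : Integrable (fun ω => 2 * (W z ω * W x ω) + 2 * c * (W z ω * W y ω)
      - 2 * c * (W x ω * W y ω)) P := i2.sub ((i x y).const_mul _)
  have h0 : ∫ ω, (W z ω - (W x ω + c * W y ω)) ^ 2 ∂P = 0 := by
    simp only [hsq]
    rw [integral_sub i1 i3, integral_add i0 ((i y y).const_mul _),
      integral_add (i z z) (i x x), integral_sub i2 ((i x y).const_mul _),
      integral_add ((i z x).const_mul _) ((i z y).const_mul _)]
    simp only [integral_const_mul, hW.cov]
    rw [hz]
    simp only [inner_add_left, inner_add_right, real_inner_smul_left, real_inner_smul_right,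
      real_inner_comm y x]
    ring
  rw [integral_eq_zero_iff_of_nonneg (fun ω => sq_nonneg _)
    (by simp only [hsq]; exact i1.sub i3)] at h0
  filter_upwards [h0] with ω hω
  have := pow_eq_zero_iff (two_ne_zero) |>.1 hω
  linarith

theorem zero_ae (hW : IsWhiteNoise P W) : W 0 =ᵐ[P] 0 := by
  have h := hW.add_smul_ae 0 0 1
  simp only [smul_zero, add_zero, one_mul] at h
  filter_upwards [h] with ω hω
  simpa using hω

theorem sub_ae (hW : IsWhiteNoise P W) (x y : L2 d) :
    W (x - y) =ᵐ[P] fun ω => W x ω - W y ω := by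
  filter_upwards [hW.add_smul_ae x y (-1)] with ω hω
  rw [sub_eq_add_neg, ← neg_one_smul ℝ y, hω]
  ring

theorem sum_smul_ae (hW : IsWhiteNoise P W) {ι : Type*} (s : Finset ι) (c : ι → ℝ)
    (h : ι → L2 d) : W (∑ i ∈ s, c i • h i) =ᵐ[P] fun ω => ∑ i ∈ s, c i * W (h i) ω := by
  classical
  induction s using Finset.induction_on with
  | empty =>
    simp only [Finset.sum_empty]
    exact hW.zero_ae
  | insert i s hi ih =>
    simp only [Finset.sum_insert hi]
    rw [add_comm]
    filter_upwards [ih, hW.add_smul_ae (∑ i ∈ s, c i • h i) (h i) (c i)] with ω h1 h2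
    rw [h2, h1]
    ring

theorem map_eq (hW : IsWhiteNoise P W) [IsProbabilityMeasure P] (h : L2 d) :
    P.map (W h) = gaussianReal 0 (‖h‖ ^ 2).toNNReal := by
  rw [(hW.gaussian.hasGaussianLaw_eval h).map_eq_gaussianReal, hW.mean h,
    variance_of_integral_eq_zero (hW.measurable h).aemeasurable (hW.mean h)]
  simp only [pow_two]
  rw [hW.cov, real_inner_self_eq_norm_mul_norm]

theorem integrable_exp (hW : IsWhiteNoise P W) [IsProbabilityMeasure P] (h : L2 d) (t : ℝ) :
    Integrable (fun ω => Real.exp (t * W h ω)) P := by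
  have := integrable_exp_mul_gaussianReal (μ := 0) (v := (‖h‖ ^ 2).toNNReal) t
  rw [← hW.map_eq h] at this
  exact this.comp_measurable (hW.measurable h)

theorem integral_exp (hW : IsWhiteNoise P W) [IsProbabilityMeasure P] (h : L2 d) :
    ∫ ω, Real.exp (W h ω) ∂P = Real.exp (‖h‖ ^ 2 / 2) := by
  have := mgf_gaussianReal (hW.map_eq h) 1
  simpa [mgf, Real.coe_toNNReal _ (sq_nonneg ‖h‖)] using this

theorem measurable_likelihood (hW : IsWhiteNoise P W) (u : L2 d) :
    Measurable (likelihood W u) :=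
  ((hW.measurable u).sub_const _).exp

theorem integrable_likelihood (hW : IsWhiteNoise P W) [IsProbabilityMeasure P] (u : L2 d) :
    Integrable (likelihood W u) P := by
  have := (hW.integrable_exp u 1).mul_const (Real.exp (-(‖u‖ ^ 2 / 2)))
  refine this.congr (Eventually.of_forall fun ω => ?_)
  simp only [likelihood]
  rw [← Real.exp_add, one_mul, sub_eq_add_neg]

theorem isFiniteMeasure_withDensity (hW : IsWhiteNoise P W) [IsProbabilityMeasure P] (u : L2 d) :
    IsFiniteMeasure (P.withDensity fun ω => ENNReal.ofReal (likelihood W u ω)) :=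
  isFiniteMeasure_withDensity_ofReal (hW.integrable_likelihood u).2

/-- Under the tilted measure, `W v` has the moment generating function of `N(⟪u, v⟫, ‖v‖²)`. -/
theorem mgf_withDensity (hW : IsWhiteNoise P W) [IsProbabilityMeasure P] (u v : L2 d) (t : ℝ) :
    mgf (W v) (P.withDensity fun ω => ENNReal.ofReal (likelihood W u ω)) t
      = Real.exp (t * inner ℝ u v + t ^ 2 * ‖v‖ ^ 2 / 2) := by
  rw [mgf, integral_withDensity_eq_integral_toReal_smul
    (hW.measurable_likelihood u).ennreal_ofReal (by simp)]
  have : (fun ω => (ENNReal.ofReal (likelihood W u ω)).toReal • Real.exp (t * W v ω)) =ᵐ[P]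
      fun ω => Real.exp (-(‖u‖ ^ 2 / 2)) * Real.exp (W (u + t • v) ω) := by
    filter_upwards [hW.add_smul_ae u v t] with ω hω
    rw [hω, likelihood, ENNReal.toReal_ofReal (Real.exp_pos _).le, smul_eq_mul, ← Real.exp_add,
      ← Real.exp_add]
    congr 1
    ring
  rw [integral_congr_ae this, integral_const_mul, hW.integral_exp, ← Real.exp_add,
    norm_add_sq_real, norm_smul, real_inner_smul_right, mul_pow, Real.norm_eq_abs, sq_abs]
  congr 1
  ring

theorem mgf_add_const (hW : IsWhiteNoise P W) [IsProbabilityMeasure P] (v : L2 d) (c t : ℝ) :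
    mgf (fun ω => W v ω + c) P t = Real.exp (t * c + t ^ 2 * ‖v‖ ^ 2 / 2) := by
  have := mgf_gaussianReal (hW.map_eq v) t
  rw [_root_.ProbabilityTheory.mgf_add_const, this, ← Real.exp_add,
    Real.coe_toNNReal _ (sq_nonneg ‖v‖)]
  congr 1
  ring

/-- The characteristic function of `W v + ⟪u, v⟫` agrees with the one of `W v` under the tilted
measure, as both have the same moment generating function. -/
theorem integral_cexp_withDensity (hW : IsWhiteNoise P W) [IsProbabilityMeasure P] (u v : L2 d) :
    ∫ ω, Complex.exp (((W v ω + inner ℝ u v : ℝ) : ℂ) * Complex.I) ∂P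
      = ∫ ω, Complex.exp ((W v ω : ℂ) * Complex.I)
          ∂(P.withDensity fun ω => ENNReal.ofReal (likelihood W u ω)) := by
  have h := eqOn_complexMGF_of_mgf (X := fun ω => W v ω + inner ℝ u v) (μ := P) (Y := W v)
    (μ' := P.withDensity fun ω => ENNReal.ofReal (likelihood W u ω)) (by
      ext t
      rw [hW.mgf_withDensity, hW.mgf_add_const])
  have hI : Complex.I ∈ {z : ℂ | z.re ∈
      interior (integrableExpSet (fun ω => W v ω + inner ℝ u v) P)} := by
    have : integrableExpSet (fun ω => W v ω + inner ℝ u v) P = Set.univ := by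
      refine Set.eq_univ_of_forall fun t => ?_
      have := (hW.integrable_exp v t).mul_const (Real.exp (t * inner ℝ u v))
      refine this.congr (Eventually.of_forall fun ω => ?_)
      simp only []
      rw [← Real.exp_add, mul_add]
    rw [this]
    simp
  have h2 := h hI
  simpa only [complexMGF, mul_comm Complex.I] using h2

/-- **Cameron–Martin formula**: the law of the shifted white noise `W + ⟪u, ·⟫` has the density
`exp (W u - ‖u‖² / 2)` with respect to the law of `W`. -/
theorem map_add_inner (hW : IsWhiteNoise P W) [IsProbabilityMeasure P] (u : L2 d) :
    P.map (fun ω h => W h ω + inner ℝ u h)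
      = (P.withDensity fun ω => ENNReal.ofReal (likelihood W u ω)).map (fun ω h => W h ω) := by
  classical
  have := hW.isFiniteMeasure_withDensity u
  set Q := P.withDensity fun ω => ENNReal.ofReal (likelihood W u ω) with hQ
  have hac : Q ≪ P := withDensity_absolutelyContinuous _ _
  have m1 : Measurable (fun ω (h : L2 d) => W h ω + inner ℝ u h) :=
    measurable_pi_lambda _ fun h => (hW.measurable h).add_const _
  have m2 : Measurable (fun ω (h : L2 d) => W h ω) :=
    measurable_pi_lambda _ fun h => hW.measurable h
  have key : IsProjectiveLimit (P.map (fun ω (h : L2 d) => W h ω + inner ℝ u h))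
      (fun I => (Q.map (fun ω (h : L2 d) => W h ω)).map I.restrict) := by
    intro I
    -- a linear functional of finitely many coordinates is almost surely one coordinate `W v`
    refine Measure.ext_of_charFunDual (funext fun L => ?_)
    beta_reduce at L ⊢
    have hL (w : I → ℝ) : L w = ∑ i, L (Pi.single i 1) * w i := by
      conv_lhs => rw [← Finset.univ_sum_single w, map_sum]
      refine Finset.sum_congr rfl fun i _ => ?_
      rw [mul_comm, ← smul_eq_mul, ← map_smul]
      congr 1
      ext j
      rw [Pi.smul_apply, Pi.single_apply, Pi.single_apply]
      split_ifs <;> simp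
    set v : L2 d := ∑ i : I, L (Pi.single i 1) • (i : L2 d) with hv
    have hWv := hW.sum_smul_ae Finset.univ (fun i : I => L (Pi.single i 1)) (fun i => (i : L2 d))
    rw [← hv] at hWv
    rw [charFunDual_apply, charFunDual_apply, Measure.map_map (Finset.measurable_restrict I) m1,
      Measure.map_map (Finset.measurable_restrict I) m2,
      integral_map ((Finset.measurable_restrict I).comp m1).aemeasurable
        (by fun_prop),
      integral_map ((Finset.measurable_restrict I).comp m2).aemeasurable
        (by fun_prop)]
    refine Eq.trans (integral_congr_ae ?_) ((hW.integral_cexp_withDensity u v).trans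
      (integral_congr_ae ?_))
    · filter_upwards [hWv] with ω hω
      rw [hL, hω, hv, inner_sum]
      simp only [Function.comp_apply, Finset.restrict_def, real_inner_smul_right, mul_add,
        Finset.sum_add_distrib]
    · filter_upwards [hac.ae_le hWv] with ω hω
      rw [hL, hω]
      simp only [Function.comp_apply, Finset.restrict_def]
  exact key.unique fun I => rfl

theorem lintegral_add_inner (hW : IsWhiteNoise P W) [IsProbabilityMeasure P] (u : L2 d)
    {F : (L2 d → ℝ) → ℝ≥0∞} (hF : Measurable F) :
    ∫⁻ ω, F (fun h => W h ω + inner ℝ u h) ∂P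
      = ∫⁻ ω, ENNReal.ofReal (likelihood W u ω) * F (fun h => W h ω) ∂P := by
  have m1 : Measurable (fun ω (h : L2 d) => W h ω + inner ℝ u h) :=
    measurable_pi_lambda _ fun h => (hW.measurable h).add_const _
  have m2 : Measurable (fun ω (h : L2 d) => W h ω) :=
    measurable_pi_lambda _ fun h => hW.measurable h
  rw [← lintegral_map hF m1, hW.map_add_inner u, lintegral_map hF m2]
  exact lintegral_withDensity_eq_lintegral_mul _ (hW.measurable_likelihood u).ennreal_ofReal
    (hF.comp m2)

end IsWhiteNoise

theorem lintegral_exp_sq_div_four_le :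
    ∫⁻ x, ENNReal.ofReal (Real.exp (x ^ 2 / 4)) ∂(gaussianReal 0 1) ≤ 2 := by
  rw [gaussianReal_of_var_ne_zero _ one_ne_zero,
    lintegral_withDensity_eq_lintegral_mul _ (measurable_gaussianPDF 0 1) (by fun_prop)]
  have e (x : ℝ) : (gaussianPDF 0 1 * fun x => ENNReal.ofReal (Real.exp (x ^ 2 / 4))) x
      = ENNReal.ofReal ((√(2 * Real.pi))⁻¹ * Real.exp (-(1 / 4) * x ^ 2)) := by
    rw [Pi.mul_apply, gaussianPDF, ← ENNReal.ofReal_mul (gaussianPDFReal_nonneg _ _ _),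
      gaussianPDFReal, mul_assoc, ← Real.exp_add]
    simp only [NNReal.coe_one, mul_one]
    congr 3
    ring
  simp only [e]
  rw [← ofReal_integral_eq_lintegral_ofReal
    ((integrable_exp_neg_mul_sq (by norm_num)).const_mul _)
    (Eventually.of_forall fun x => by positivity), integral_const_mul, integral_gaussian]
  refine ENNReal.ofReal_le_of_le_toReal ?_
  rw [← Real.sqrt_inv, ← Real.sqrt_mul (by positivity)]
  refine Real.sqrt_le_iff.2 ⟨by simp, ?_⟩
  have := Real.pi_ne_zero
  field_simp
  norm_num

theorem lintegral_exp_sq_div_le {v : NNReal} {s : ℝ} (hs : 0 < s) (hv : (v : ℝ) ≤ s) :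
    ∫⁻ x, ENNReal.ofReal (Real.exp (x ^ 2 / (4 * s))) ∂(gaussianReal 0 v) ≤ 2 := by
  have h := gaussianReal_map_const_mul (μ := 0) (v := 1) (√(v : ℝ))
  have hv' : NNReal.mk (√(v : ℝ) ^ 2) (sq_nonneg _) * 1 = v := by
    ext
    simp
  rw [mul_zero, hv'] at h
  rw [← h, lintegral_map (by fun_prop) (by fun_prop)]
  refine (lintegral_mono fun x => ?_).trans lintegral_exp_sq_div_four_le
  refine ENNReal.ofReal_le_ofReal (Real.exp_le_exp.2 ?_)
  rw [mul_pow, Real.sq_sqrt v.coe_nonneg, div_le_div_iff₀ (by positivity) (by norm_num)]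
  nlinarith [mul_le_mul_of_nonneg_right hv (sq_nonneg x)]

theorem IsWhiteNoise.lintegral_exp_sq_le (hW : IsWhiteNoise P W) [IsProbabilityMeasure P]
    (x y : L2 d) {s : ℝ} (hs : 0 < s) (h : ‖x - y‖ ^ 2 ≤ s) :
    ∫⁻ ω, ENNReal.ofReal (Real.exp ((W x ω - W y ω) ^ 2 / (4 * s))) ∂P ≤ 2 := by
  have e : (fun ω => ENNReal.ofReal (Real.exp ((W x ω - W y ω) ^ 2 / (4 * s)))) =ᵐ[P]
      fun ω => ENNReal.ofReal (Real.exp ((W (x - y) ω) ^ 2 / (4 * s))) := by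
    filter_upwards [hW.sub_ae x y] with ω hω
    rw [hω]
  rw [lintegral_congr_ae e]
  have := lintegral_map (μ := P) (f := fun z : ℝ => ENNReal.ofReal (Real.exp (z ^ 2 / (4 * s))))
    (by fun_prop) (hW.measurable (x - y))
  rw [← this, hW.map_eq]
  exact lintegral_exp_sq_div_le hs (by rwa [Real.coe_toNNReal _ (sq_nonneg _)])

end

/-! ### The risk of net estimators -/

section

variable {d : ℕ} {Ω : Type*} {W : L2 d → Ω → ℝ}

theorem measurable_empiricalRisk (a : UnitAddTorus (Fin d) → ℝ) (g : L2 d) :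
    Measurable fun y => empiricalRisk a y g :=
  ((measurable_pi_apply _).const_mul _).add_const _

/-- A measurable minimizer exists, by induction on the net: a new element replaces the minimizer
over the others where its risk is at most as large. -/
theorem exists_isNetEstimator (a : UnitAddTorus (Fin d) → ℝ) {N : Finset (L2 d)}
    (hN : N.Nonempty) : ∃ fhat, IsNetEstimator a N fhat := by
  suffices h : ∃ fhat, IsNetEstimator a N fhat ∧ Measurable fun y => empiricalRisk a y (fhat y) by
    obtain ⟨fhat, h, -⟩ := h
    exact ⟨fhat, h⟩
  induction hN using Finset.Nonempty.cons_induction with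
  | singleton g =>
    refine ⟨fun _ => g, ⟨stronglyMeasurable_const, by simp, by simp⟩, measurable_empiricalRisk a g⟩
  | cons g s hg hs ih =>
    classical
    obtain ⟨fhat, h, hm⟩ := ih
    have hset : MeasurableSet {y | empiricalRisk a y g ≤ empiricalRisk a y (fhat y)} :=
      measurableSet_le (measurable_empiricalRisk a g) hm
    refine ⟨fun y => if empiricalRisk a y g ≤ empiricalRisk a y (fhat y) then g else fhat y,
      ⟨StronglyMeasurable.ite hset stronglyMeasurable_const h.estimator, fun y => ?_,
        fun y g' hg' => ?_⟩, ?_⟩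
    · split_ifs
      · simp
      · simp [h.mem y]
    · rcases Finset.mem_cons.1 hg' with rfl | hg'
      · split_ifs with h1
        · exact le_rfl
        · exact (not_le.1 h1).le
      · split_ifs with h1
        · exact h1.trans (h.minimizes y g' hg')
        · exact h.minimizes y g' hg'
    · have : (fun y => empiricalRisk a y
          (if empiricalRisk a y g ≤ empiricalRisk a y (fhat y) then g else fhat y)) =
          fun y => if empiricalRisk a y g ≤ empiricalRisk a y (fhat y) then empiricalRisk a y g
            else empiricalRisk a y (fhat y) := by
        ext y
        split_ifs <;> rfl
      rw [this]
      exact Measurable.ite hset (measurable_empiricalRisk a g) hm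

/-- The squared increment of the noise between `g₀` and `g`, divided by four times an upper bound
for its variance if `‖Q g - Q g₀‖ ≤ κ ‖g - g₀‖`. For `g = g₀` it has the value `0`. -/
def noiseRatio (a : UnitAddTorus (Fin d) → ℝ) (W : L2 d → Ω → ℝ) (κ : ℝ) (g₀ g : L2 d) (ω : Ω) :
    ℝ :=
  (W (adjointInverse a g) ω - W (adjointInverse a g₀) ω) ^ 2 / (4 * (κ ^ 2 * ‖g - g₀‖ ^ 2))

/-- Comparison of the minimizer `g` with any other element `g₀` of the net. -/
theorem norm_sub_sq_le_of_empiricalRisk_le {a : UnitAddTorus (Fin d) → ℝ} {n : ℕ}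
    {κ δ : ℝ} (hκ : 0 < κ) {f g g₀ : L2 d} {ω : Ω}
    (hg : IsAdjointInverse a g (adjointInverse a g))
    (hg₀ : IsAdjointInverse a g₀ (adjointInverse a g₀)) (hδ : ‖f - g₀‖ ≤ δ)
    (h : empiricalRisk a (observation a W n f ω) g ≤ empiricalRisk a (observation a W n f ω) g₀) :
    ‖g - f‖ ^ 2 ≤ 3 * δ ^ 2 + 32 * κ ^ 2 / n * noiseRatio a W κ g₀ g ω := by
  set Z := W (adjointInverse a g) ω - W (adjointInverse a g₀) ω with hZ
  have hδ2 : ‖f - g₀‖ ^ 2 ≤ δ ^ 2 := by gcongr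
  have basic : ‖g - f‖ ^ 2 ≤ ‖f - g₀‖ ^ 2 + 2 * (√(n : ℝ))⁻¹ * Z := by
    have e1 := hg f
    have e2 := hg₀ f
    rw [← inner_eq_integral] at e1 e2
    simp only [empiricalRisk, observation] at h
    rw [← e1, ← e2] at h
    rw [norm_sub_rev f g₀, norm_sub_sq_real, norm_sub_sq_real, real_inner_comm f g,
      real_inner_comm f g₀]
    rw [hZ]
    linarith
  by_cases hgg : g = g₀
  · subst hgg
    have : Z = 0 := sub_self _
    rw [this] at basic
    have : noiseRatio a W κ g g ω = 0 := by simp [noiseRatio]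
    rw [this]
    nlinarith [sq_nonneg δ]
  · have hr : 0 < ‖g - g₀‖ := norm_pos_iff.2 (sub_ne_zero.2 hgg)
    have hn : 0 ≤ (√(n : ℝ))⁻¹ := by positivity
    have hn2 : (√(n : ℝ))⁻¹ ^ 2 = (n : ℝ)⁻¹ := by
      rw [inv_pow, Real.sq_sqrt (Nat.cast_nonneg n)]
    have e3 : 32 * κ ^ 2 / n * noiseRatio a W κ g₀ g ω
        = 2 * (2 * (√(n : ℝ))⁻¹ * Z / ‖g - g₀‖) ^ 2 := by
      rw [noiseRatio, div_pow, mul_pow, mul_pow, hn2, ← hZ]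
      have := hκ.ne'
      have := hr.ne'
      field_simp
      ring
    -- the weights leave half of `‖g - f‖²` on the left hand side
    have young : 2 * (√(n : ℝ))⁻¹ * Z
        ≤ ‖g - g₀‖ ^ 2 / 4 + (2 * (√(n : ℝ))⁻¹ * Z / ‖g - g₀‖) ^ 2 := by
      set w := 2 * (√(n : ℝ))⁻¹ * Z / ‖g - g₀‖ with hw
      have : 2 * (√(n : ℝ))⁻¹ * Z = w * ‖g - g₀‖ := by
        rw [hw, div_mul_cancel₀ _ hr.ne']
      rw [this]
      nlinarith [sq_nonneg (‖g - g₀‖ / 2 - w)]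
    have tri : ‖g - g₀‖ ^ 2 ≤ 2 * ‖g - f‖ ^ 2 + 2 * ‖f - g₀‖ ^ 2 := by
      have h1 : ‖g - g₀‖ ≤ ‖g - f‖ + ‖f - g₀‖ := by
        simpa using norm_add_le (g - f) (f - g₀)
      have h2 := pow_le_pow_left₀ hr.le h1 2
      nlinarith [sq_nonneg (‖g - f‖ - ‖f - g₀‖)]
    rw [e3]
    nlinarith

variable [MeasurableSpace Ω] {P : Measure Ω}

/-- The risk bound for a net estimator: `δ²` from the approximation by the net, and
`κ² log #N / n` from the maximum of `#N` Gaussian variables. -/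
theorem mise_le_of_isNetEstimator [IsProbabilityMeasure P] (hW : IsWhiteNoise P W)
    {a : UnitAddTorus (Fin d) → ℝ} (ha : MemLp a 2 (torusMeasure d)) (ha0 : ∀ m, fc a m ≠ 0)
    {B : Set (Fin d → ℤ)} (hB : B.Finite) {κ : ℝ} (hκ : 0 < κ)
    (h : ∀ m ∈ B, 1 ≤ κ * ‖fc a m‖) {N : Finset (L2 d)} (hNB : ∀ g ∈ N, g ∈ bandlimited B)
    {fhat : (L2 d → ℝ) → L2 d} (hf : IsNetEstimator a N fhat) {n : ℕ} {f g₀ : L2 d}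
    (hg₀ : g₀ ∈ N) {δ : ℝ} (hδ : ‖f - g₀‖ ≤ δ) :
    mise P a W n fhat f ≤ ENNReal.ofReal
      (3 * δ ^ 2 + 32 * κ ^ 2 / n * (Real.log N.card + 2)) := by
  have hQ (g) (hg : g ∈ N) := isAdjointInverse_adjointInverse ha ha0 hB (hNB g hg)
  have hc : 0 < (N.card : ℝ) := by exact_mod_cast Finset.card_pos.2 ⟨g₀, hg₀⟩
  have hc1 : 1 ≤ (N.card : ℝ) := by exact_mod_cast Finset.card_pos.2 ⟨g₀, hg₀⟩
  have hl : 0 ≤ Real.log N.card := Real.log_nonneg hc1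
  have hk : 0 ≤ 32 * κ ^ 2 / n := by positivity
  have pt (ω : Ω) : ‖fhat (observation a W n f ω) - f‖ₑ ^ 2 ≤
      ENNReal.ofReal (3 * δ ^ 2 + 32 * κ ^ 2 / n * Real.log N.card)
        + ENNReal.ofReal (32 * κ ^ 2 / n / N.card) *
          ∑ g ∈ N, ENNReal.ofReal (Real.exp (noiseRatio a W κ g₀ g ω)) := by
    set y := observation a W n f ω
    have h1 := norm_sub_sq_le_of_empiricalRisk_le hκ (hQ _ (hf.mem y)) (hQ _ hg₀) hδ
      (hf.minimizes y g₀ hg₀)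
    set g := fhat y
    -- `x ≤ log c + exp x / c` with `c = #N` replaces the maximum over the net by a sum
    have h2 : noiseRatio a W κ g₀ g ω ≤
        Real.log N.card + (∑ g ∈ N, Real.exp (noiseRatio a W κ g₀ g ω)) / N.card := by
      have h3 := Real.add_one_le_exp (noiseRatio a W κ g₀ g ω - Real.log N.card)
      rw [Real.exp_sub, Real.exp_log hc] at h3
      have h4 : Real.exp (noiseRatio a W κ g₀ g ω) / N.card
          ≤ (∑ g ∈ N, Real.exp (noiseRatio a W κ g₀ g ω)) / N.card := by
        gcongr
        exact Finset.single_le_sum (f := fun g => Real.exp (noiseRatio a W κ g₀ g ω))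
          (fun _ _ => (Real.exp_pos _).le) (hf.mem y)
      linarith
    have h5 : ‖g - f‖ ^ 2 ≤ (3 * δ ^ 2 + 32 * κ ^ 2 / n * Real.log N.card)
        + 32 * κ ^ 2 / n / N.card * ∑ g ∈ N, Real.exp (noiseRatio a W κ g₀ g ω) := by
      refine h1.trans ?_
      have := mul_le_mul_of_nonneg_left h2 hk
      have e : 32 * κ ^ 2 / n / N.card * ∑ g ∈ N, Real.exp (noiseRatio a W κ g₀ g ω)
        = 32 * κ ^ 2 / n * ((∑ g ∈ N, Real.exp (noiseRatio a W κ g₀ g ω)) / N.card) := by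
        ring
      rw [e]
      linarith
    rw [← ofReal_norm, ← ENNReal.ofReal_pow (norm_nonneg _)]
    refine (ENNReal.ofReal_le_ofReal h5).trans ?_
    rw [ENNReal.ofReal_add (by positivity)
      (mul_nonneg (by positivity) (Finset.sum_nonneg fun _ _ => (Real.exp_pos _).le)),
      ENNReal.ofReal_mul (by positivity),
      ENNReal.ofReal_sum_of_nonneg fun _ _ => (Real.exp_pos _).le]
  have hmeas (g : L2 d) : Measurable (noiseRatio a W κ g₀ g) :=
    (((hW.measurable _).sub (hW.measurable _)).pow_const 2).div_const _
  have hexp (g) (hg : g ∈ N) :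
      ∫⁻ ω, ENNReal.ofReal (Real.exp (noiseRatio a W κ g₀ g ω)) ∂P ≤ 2 := by
    by_cases hgg : g = g₀
    · subst hgg
      simp [noiseRatio]
    · have hr : 0 < ‖g - g₀‖ := norm_pos_iff.2 (sub_ne_zero.2 hgg)
      refine hW.lintegral_exp_sq_le _ _ (by positivity) ?_
      rw [← mul_pow]
      gcongr
      exact norm_adjointInverse_sub_le ha ha0 hB hκ.le h (hNB g hg) (hNB g₀ hg₀)
  calc mise P a W n fhat f
      ≤ ∫⁻ ω, (ENNReal.ofReal (3 * δ ^ 2 + 32 * κ ^ 2 / n * Real.log N.card)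
        + ENNReal.ofReal (32 * κ ^ 2 / n / N.card) *
          ∑ g ∈ N, ENNReal.ofReal (Real.exp (noiseRatio a W κ g₀ g ω))) ∂P := lintegral_mono pt
    _ = ENNReal.ofReal (3 * δ ^ 2 + 32 * κ ^ 2 / n * Real.log N.card)
        + ENNReal.ofReal (32 * κ ^ 2 / n / N.card) *
          ∑ g ∈ N, ∫⁻ ω, ENNReal.ofReal (Real.exp (noiseRatio a W κ g₀ g ω)) ∂P := by
      have m (g : L2 d) : Measurable fun ω =>
          ENNReal.ofReal (Real.exp (noiseRatio a W κ g₀ g ω)) := (hmeas g).exp.ennreal_ofReal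
      rw [lintegral_add_left measurable_const, lintegral_const, measure_univ, mul_one,
        lintegral_const_mul _ (Finset.measurable_sum _ fun g _ => m g),
        lintegral_finsetSum _ fun g _ => m g]
    _ ≤ ENNReal.ofReal (3 * δ ^ 2 + 32 * κ ^ 2 / n * Real.log N.card)
        + ENNReal.ofReal (32 * κ ^ 2 / n / N.card) * (N.card * 2) := by
      gcongr
      refine (Finset.sum_le_sum hexp).trans ?_
      rw [Finset.sum_const, nsmul_eq_mul]
    _ = _ := by
      have e : (N.card * 2 : ℝ≥0∞) = ENNReal.ofReal (N.card * 2 : ℝ) := by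
        rw [ENNReal.ofReal_mul (Nat.cast_nonneg _)]
        simp
      rw [e, ← ENNReal.ofReal_mul (by positivity), ← ENNReal.ofReal_add (by positivity)
        (by positivity)]
      congr 1
      have := hc.ne'
      field_simp
      ring

theorem mem_bandlimited_of_mem_span {M : ℝ} {g : L2 d}
    (hg : g ∈ Submodule.span ℝ (trigLp '' {p : TrigIndex d | ∀ i, (p.1.1 i : ℝ) ≤ M})) :
    g ∈ bandlimited {m : Fin d → ℤ | ∀ i, |(m i : ℝ)| ≤ M} := by
  refine Submodule.span_le.2 ?_ hg
  rintro _ ⟨p, hp, rfl⟩ m hm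
  simp only [Set.mem_ofPred_eq, not_forall, not_le] at hm
  obtain ⟨i, hi⟩ := hm
  refine fc_trigLp_eq_zero (i := i) fun h => ?_
  have h1 := hp i
  rw [← h, Nat.cast_natAbs, Int.cast_abs] at h1
  exact absurd h1 (not_le.2 hi)

theorem finite_box (M : ℝ) : {m : Fin d → ℤ | ∀ i, |(m i : ℝ)| ≤ M}.Finite := by
  have : {m : Fin d → ℤ | ∀ i, |(m i : ℝ)| ≤ M} ⊆ Set.univ.pi fun _ => Set.Icc (-⌊M⌋) ⌊M⌋ := by
    intro m hm i _
    have h := abs_le.1 (hm i)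
    have h1 : m i ≤ ⌊M⌋ := Int.le_floor.2 h.2
    have h2 : -(m i) ≤ ⌊M⌋ := Int.le_floor.2 (by push_cast; linarith [h.1])
    exact ⟨by linarith, h1⟩
  exact (Set.Finite.pi' fun _ => Set.finite_Icc (-⌊M⌋) ⌊M⌋).subset fun m hm i => this hm i trivial

theorem one_le_freqSize {m : Fin d → ℤ} (hm : m ≠ 0) : 1 ≤ freqSize m := by
  obtain ⟨i, hi⟩ := Function.ne_iff.1 hm
  have h1 : (1 : ℝ) ≤ |(m i : ℝ)| := by exact_mod_cast Int.one_le_abs hi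
  exact h1.trans (Finset.single_le_sum (f := fun i => |(m i : ℝ)|) (fun _ _ => abs_nonneg _)
    (Finset.mem_univ i))

/-- On the box of frequencies up to `M`, the inverse of the filter grows at most like `M ^ q`. -/
theorem one_le_mul_norm_fc {q : ℝ} (hq : 0 ≤ q) {a : UnitAddTorus (Fin d) → ℝ} {C₂ : ℝ}
    (hC₂ : 0 < C₂) (hb : ∀ m : Fin d → ℤ, m ≠ 0 → C₂ * freqSize m ^ (-q) ≤ ‖fc a m‖)
    (hb0 : fc a 0 ≠ 0) {M : ℝ} {m : Fin d → ℤ} (hM : 0 ≤ M) (hm : ∀ i, |(m i : ℝ)| ≤ M) :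
    1 ≤ (C₂⁻¹ * (d * M) ^ q + ‖fc a 0‖⁻¹) * ‖fc a m‖ := by
  have hdM : 0 ≤ (d * M : ℝ) := by positivity
  have hp : 0 ≤ (d * M : ℝ) ^ q := Real.rpow_nonneg hdM q
  rw [add_mul]
  by_cases h0 : m = 0
  · subst h0
    rw [inv_mul_cancel₀ (norm_ne_zero_iff.2 hb0)]
    exact le_add_of_nonneg_left (by positivity)
  · refine le_add_of_le_of_nonneg ?_ (by positivity)
    have h1 := one_le_freqSize h0
    have h2 : freqSize m ≤ d * M := by
      refine (Finset.sum_le_card_nsmul _ _ M fun i _ => hm i).trans ?_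
      simp
    have h3 : freqSize m ^ q ≤ (d * M : ℝ) ^ q := by gcongr
    have h4 : 0 < freqSize m ^ q := by positivity
    have h5 := hb m h0
    rw [Real.rpow_neg (by linarith)] at h5
    calc (1 : ℝ) = C₂⁻¹ * freqSize m ^ q * (C₂ * (freqSize m ^ q)⁻¹) := by
          field_simp
      _ ≤ C₂⁻¹ * (d * M) ^ q * ‖fc a m‖ := by gcongr

/-- The net estimator attains the rate `n ^ (-2s / (2s + 2q + d))`. -/
theorem limsup_mise_lt_top {s q : ℝ} (hs : 0 < s) (hq : 0 ≤ q)
    {F : Set (L2 d)} {a : UnitAddTorus (Fin d) → ℝ} (ha : MemLp a 2 (torusMeasure d))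
    {C₂ : ℝ} (hC₂ : 0 < C₂)
    (hb : ∀ m : Fin d → ℤ, m ≠ 0 → C₂ * freqSize m ^ (-q) ≤ ‖fc a m‖) (hb0 : fc a 0 ≠ 0)
    [IsProbabilityMeasure P] (hW : IsWhiteNoise P W) {K c C : ℝ} {δ : ℕ → ℝ}
    {N : ℕ → Finset (L2 d)} {fhat : ℕ → (L2 d → ℝ) → L2 d} (hK : 0 < K) (hc : 0 < c) (hC : 0 < C)
    (hδ : ∀ n : ℕ, 1 ≤ n → c * (n : ℝ) ^ (-(s / (2 * s + 2 * q + d))) ≤ δ n ∧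
      δ n ≤ C * (n : ℝ) ^ (-(s / (2 * s + 2 * q + d))))
    (hN : ∀ n : ℕ, 1 ≤ n → IsPolynomialNet F s K (δ n) (N n))
    (hf : ∀ n : ℕ, 1 ≤ n → IsNetEstimator a (N n) (fhat n)) :
    limsup (fun n : ℕ => ENNReal.ofReal ((n : ℝ) ^ (2 * s / (2 * s + 2 * q + d))) *
      ⨆ f ∈ F, mise P a W n (fhat n) f) atTop < ⊤ := by
  have hr : 0 < 2 * s + 2 * q + d := by positivity
  set r := 2 * s + 2 * q + d with hr_def
  have ha0 : ∀ m, fc a m ≠ 0 := by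
    intro m
    by_cases h0 : m = 0
    · rwa [h0]
    · have h1 := one_le_freqSize h0
      have h2 : 0 < C₂ * freqSize m ^ (-q) := by positivity
      exact norm_pos_iff.1 (h2.trans_le (hb m h0))
  set κ₀ := C₂⁻¹ * (d * K) ^ q + ‖fc a 0‖⁻¹ * C ^ (q / s) with hκ₀
  set R := 3 * C ^ 2 + 32 * κ₀ ^ 2 * (K + 2 * C ^ (d / s)) * c ^ (-((2 * q + d) / s)) with hR
  refine lt_of_le_of_lt (limsup_le_of_le ⟨0, by simp⟩ ?_) (ENNReal.ofReal_lt_top (r := R))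
  filter_upwards [eventually_ge_atTop 1] with n hn
  have hn1 : (1 : ℝ) ≤ n := by exact_mod_cast hn
  have hn0 : (0 : ℝ) < n := by linarith
  obtain ⟨hl, hu⟩ := hδ n hn
  set t := (n : ℝ) ^ (-(s / r)) with ht
  have ht0 : 0 < t := by positivity
  have ht1 : t ≤ 1 := Real.rpow_le_one_of_one_le_of_nonpos hn1 (by
    rw [neg_nonpos]; positivity)
  have hδ0 : 0 < δ n := lt_of_lt_of_le (by positivity) hl
  have hδC : δ n ≤ C := hu.trans (mul_le_of_le_one_right hC.le ht1)
  -- negative powers of `δ` are bounded below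
  have hpow (e : ℝ) (he : 0 ≤ e) : 1 ≤ C ^ e * δ n ^ (-e) := by
    rw [Real.rpow_neg hδ0.le, ← div_eq_mul_inv, one_le_div (by positivity)]
    gcongr
  set M := K * δ n ^ (-(1 / s)) with hM
  have hM0 : 0 ≤ M := by positivity
  set κ := C₂⁻¹ * (d * M) ^ q + ‖fc a 0‖⁻¹ with hκ
  have hκ0 : 0 < κ := by
    have : 0 < ‖fc a 0‖ := norm_pos_iff.2 hb0
    positivity
  have hκle : κ ≤ κ₀ * δ n ^ (-(q / s)) := by
    have e1 : (d * M : ℝ) ^ q = (d * K) ^ q * δ n ^ (-(q / s)) := by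
      rw [hM, ← mul_assoc, Real.mul_rpow (by positivity) (by positivity), ← Real.rpow_mul hδ0.le]
      congr 2
      ring
    rw [hκ, e1, hκ₀, add_mul, ← mul_assoc]
    gcongr
    rw [mul_assoc]
    exact le_mul_of_one_le_right (by positivity) (hpow _ (by positivity))
  have hlog : Real.log (N n).card + 2 ≤ (K + 2 * C ^ (d / s)) * δ n ^ (-((d : ℝ) / s)) := by
    have := (hN n hn).entropy
    have := hpow (d / s) (by positivity)
    nlinarith
  have hbound (f) (hfF : f ∈ F) : mise P a W n (fhat n) f ≤ ENNReal.ofReal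
      (3 * δ n ^ 2 + 32 * κ ^ 2 / n * (Real.log (N n).card + 2)) := by
    obtain ⟨g₀, hg₀, hfg⟩ := (hN n hn).net f hfF
    exact mise_le_of_isNetEstimator hW ha ha0 (finite_box M) hκ0
      (fun m hm => one_le_mul_norm_fc hq hC₂ hb hb0 hM0 hm)
      (fun g hg => mem_bandlimited_of_mem_span ((hN n hn).support g hg)) (hf n hn) hg₀ hfg
  calc ENNReal.ofReal ((n : ℝ) ^ (2 * s / r)) * ⨆ f ∈ F, mise P a W n (fhat n) f
      ≤ ENNReal.ofReal ((n : ℝ) ^ (2 * s / r)) * ENNReal.ofReal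
        (3 * δ n ^ 2 + 32 * κ ^ 2 / n * (Real.log (N n).card + 2)) := by
        gcongr
        exact iSup₂_le hbound
    _ = ENNReal.ofReal ((n : ℝ) ^ (2 * s / r) *
        (3 * δ n ^ 2 + 32 * κ ^ 2 / n * (Real.log (N n).card + 2))) :=
        (ENNReal.ofReal_mul (by positivity)).symm
    _ ≤ ENNReal.ofReal R := by
        refine ENNReal.ofReal_le_ofReal ?_
        have e1 : (n : ℝ) ^ (2 * s / r) * δ n ^ 2 ≤ C ^ 2 := by
          calc (n : ℝ) ^ (2 * s / r) * δ n ^ 2 ≤ (n : ℝ) ^ (2 * s / r) * (C * t) ^ 2 := by gcongr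
            _ = C ^ 2 * ((n : ℝ) ^ (2 * s / r) * t ^ 2) := by ring
            _ = C ^ 2 := by
              rw [ht, ← Real.rpow_natCast (_ ^ _), ← Real.rpow_mul hn0.le, ← Real.rpow_add hn0]
              have : 2 * s / r + -(s / r) * ((2 : ℕ) : ℝ) = 0 := by push_cast; ring
              rw [this, Real.rpow_zero, mul_one]
        have e2 : (n : ℝ) ^ (2 * s / r) * (δ n ^ (-((2 * q + d) / s)) / n)
            ≤ c ^ (-((2 * q + d) / s)) := by
          have h1 : δ n ^ (-((2 * q + d) / s)) ≤ (c * t) ^ (-((2 * q + d) / s)) :=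
            Real.rpow_le_rpow_of_nonpos (by positivity) hl (by
              rw [neg_nonpos]; positivity)
          calc (n : ℝ) ^ (2 * s / r) * (δ n ^ (-((2 * q + d) / s)) / n)
              ≤ (n : ℝ) ^ (2 * s / r) * ((c * t) ^ (-((2 * q + d) / s)) / n) := by gcongr
            _ = c ^ (-((2 * q + d) / s)) *
                ((n : ℝ) ^ (2 * s / r) * t ^ (-((2 * q + d) / s)) * (n : ℝ)⁻¹) := by
              rw [Real.mul_rpow hc.le ht0.le]
              ring
            _ = c ^ (-((2 * q + d) / s)) := by
              rw [ht, ← Real.rpow_mul hn0.le, ← Real.rpow_add hn0, ← Real.rpow_neg_one,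
                ← Real.rpow_add hn0]
              have : 2 * s / r + -(s / r) * -((2 * q + d) / s) + -1 = 0 := by
                field_simp
                rw [hr_def]
                ring
              rw [this, Real.rpow_zero, mul_one]
        have e3 : κ ^ 2 * (Real.log (N n).card + 2)
            ≤ κ₀ ^ 2 * (K + 2 * C ^ (d / s)) * δ n ^ (-((2 * q + d) / s)) := by
          calc κ ^ 2 * (Real.log (N n).card + 2)
              ≤ (κ₀ * δ n ^ (-(q / s))) ^ 2 *
                ((K + 2 * C ^ (d / s)) * δ n ^ (-((d : ℝ) / s))) := by gcongr
            _ = κ₀ ^ 2 * (K + 2 * C ^ (d / s)) *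
                ((δ n ^ (-(q / s))) ^ 2 * δ n ^ (-((d : ℝ) / s))) := by ring
            _ = _ := by
              rw [← Real.rpow_natCast (_ ^ _), ← Real.rpow_mul hδ0.le, ← Real.rpow_add hδ0]
              congr 2
              push_cast
              ring
        calc (n : ℝ) ^ (2 * s / r) * (3 * δ n ^ 2 + 32 * κ ^ 2 / n * (Real.log (N n).card + 2))
            = 3 * ((n : ℝ) ^ (2 * s / r) * δ n ^ 2)
              + 32 * ((n : ℝ) ^ (2 * s / r) * (κ ^ 2 * (Real.log (N n).card + 2) / n)) := by ring
          _ ≤ 3 * C ^ 2 + 32 * ((n : ℝ) ^ (2 * s / r) *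
              (κ₀ ^ 2 * (K + 2 * C ^ (d / s)) * δ n ^ (-((2 * q + d) / s)) / n)) := by
            gcongr
          _ = 3 * C ^ 2 + 32 * (κ₀ ^ 2 * (K + 2 * C ^ (d / s)) *
              ((n : ℝ) ^ (2 * s / r) * (δ n ^ (-((2 * q + d) / s)) / n))) := by ring
          _ ≤ 3 * C ^ 2 + 32 * (κ₀ ^ 2 * (K + 2 * C ^ (d / s)) * c ^ (-((2 * q + d) / s))) := by
            gcongr
          _ = R := by rw [hR]; ring

end

/-! ### Metric entropy of the ellipsoid -/

section

variable {d : ℕ}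

theorem sum_exp_neg_mul_sq_le {u : ℝ} (hu : 0 < u) (R : ℕ) :
    ∑ z ∈ Finset.Icc (-R : ℤ) R, Real.exp (-u * (z : ℝ) ^ 2) ≤ 1 + 2 / u := by
  have hx : Real.exp (-u) < 1 := by simpa using hu
  have h1 : ∑ z ∈ Finset.Icc (-R : ℤ) R, Real.exp (-u * (z : ℝ) ^ 2)
      ≤ 1 + 2 * ∑ k ∈ Finset.range R, Real.exp (-u) ^ (k + 1) := by
    induction R with
    | zero => simp
    | succ R ih =>
      have e := Finset.sum_Icc_succ_eq_add_endpoints (fun z : ℤ => Real.exp (-u * (z : ℝ) ^ 2))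
        (N := R)
      push_cast at e ih ⊢
      rw [e, Finset.sum_range_succ]
      have h2 : Real.exp (-u * ((R : ℝ) + 1) ^ 2) ≤ Real.exp (-u) ^ (R + 1) := by
        rw [← Real.exp_nat_mul, Real.exp_le_exp]
        push_cast
        have : (0 : ℝ) ≤ R := Nat.cast_nonneg R
        nlinarith [mul_nonneg hu.le this, mul_nonneg hu.le (mul_nonneg this this)]
      have h3 : (-1 + -(R : ℝ)) ^ 2 = (R + 1) ^ 2 := by ring
      have h4 : (-((R : ℝ) + 1)) ^ 2 = (R + 1) ^ 2 := by ring
      simp only [h3, h4] at *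
      linarith
  have h2 : ∑ k ∈ Finset.range R, Real.exp (-u) ^ (k + 1) ≤ 1 / u := by
    have h0 := Real.exp_pos (-u)
    have hs : HasSum (fun k : ℕ => Real.exp (-u) ^ (k + 1))
        (Real.exp (-u) * (1 - Real.exp (-u))⁻¹) := by
      simpa only [pow_succ'] using (hasSum_geometric_of_lt_one h0.le hx).mul_left (Real.exp (-u))
    refine (sum_le_hasSum _ (fun k _ => by positivity) hs).trans ?_
    rw [← div_eq_mul_inv, div_le_div_iff₀ (by linarith) hu]
    have h5 := Real.add_one_le_exp u
    have h6 : Real.exp (-u) * Real.exp u = 1 := by rw [← Real.exp_add]; simp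
    nlinarith
  have : 2 / u = 2 * (1 / u) := by ring
  linarith

/-- An exponential Chebyshev bound for the number of lattice points in an ellipsoid. -/
theorem card_lattice_ellipsoid_le {ι : Type*} [Fintype ι] [DecidableEq ι] {w : ι → ℝ}
    (hw : ∀ p, 0 < w p) (X : ℝ) {t : ℝ} (ht : 0 < t) (R : ι → ℕ) :
    (((Fintype.piFinset fun p => Finset.Icc (-(R p) : ℤ) (R p)).filter
      fun z => ∑ p, w p * (z p : ℝ) ^ 2 ≤ X).card : ℝ)
      ≤ Real.exp (t * X) * ∏ p, (1 + 2 / (t * w p)) := by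
  have h1 : ∀ z : ι → ℤ, Real.exp (t * (X - ∑ p, w p * (z p : ℝ) ^ 2))
      = Real.exp (t * X) * ∏ p, Real.exp (-(t * w p) * (z p : ℝ) ^ 2) := by
    intro z
    rw [← Real.exp_sum, ← Real.exp_add, mul_sub, Finset.mul_sum, sub_eq_add_neg,
      ← Finset.sum_neg_distrib]
    congr 2
    exact Finset.sum_congr rfl fun p _ => by ring
  calc _ ≤ ∑ z ∈ (Fintype.piFinset fun p => Finset.Icc (-(R p) : ℤ) (R p)).filter
        (fun z => ∑ p, w p * (z p : ℝ) ^ 2 ≤ X),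
        Real.exp (t * (X - ∑ p, w p * (z p : ℝ) ^ 2)) := by
        rw [← nsmul_one, ← Finset.sum_const]
        refine Finset.sum_le_sum fun z hz => ?_
        rw [Real.one_le_exp_iff]
        exact mul_nonneg ht.le (sub_nonneg.2 (Finset.mem_filter.1 hz).2)
    _ ≤ ∑ z ∈ Fintype.piFinset fun p => Finset.Icc (-(R p) : ℤ) (R p),
        Real.exp (t * (X - ∑ p, w p * (z p : ℝ) ^ 2)) :=
        Finset.sum_le_sum_of_subset_of_nonneg (Finset.filter_subset _ _)
          fun _ _ _ => (Real.exp_pos _).le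
    _ = Real.exp (t * X) *
        ∏ p, ∑ z ∈ Finset.Icc (-(R p) : ℤ) (R p), Real.exp (-(t * w p) * (z : ℝ) ^ 2) := by
        simp only [h1]
        rw [← Finset.mul_sum, Finset.prod_univ_sum]
    _ ≤ _ := by
        gcongr with p
        exact sum_exp_neg_mul_sq_le (mul_pos ht (hw p)) (R p)

/-- Rounding towards zero to a multiple of `ε`. -/
theorem exists_round {ε : ℝ} (hε : 0 < ε) (θ : ℝ) :
    ∃ z : ℤ, (θ - ε * z) ^ 2 ≤ ε ^ 2 ∧ (ε * z) ^ 2 ≤ θ ^ 2 := by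
  rcases le_total 0 θ with h | h
  · have h1 := Int.floor_le (θ / ε)
    have h2 := Int.lt_floor_add_one (θ / ε)
    have h3 : (0 : ℝ) ≤ ⌊θ / ε⌋ := by exact_mod_cast Int.floor_nonneg.2 (by positivity)
    rw [le_div_iff₀ hε] at h1
    rw [div_lt_iff₀ hε] at h2
    have h4 := mul_nonneg hε.le h3
    exact ⟨⌊θ / ε⌋, pow_le_pow_left₀ (by linarith) (by linarith) 2,
      pow_le_pow_left₀ h4 (by linarith) 2⟩
  · have h1 := Int.floor_le (-θ / ε)
    have h2 := Int.lt_floor_add_one (-θ / ε)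
    have h3 : (0 : ℝ) ≤ ⌊-θ / ε⌋ := by
      exact_mod_cast Int.floor_nonneg.2 (div_nonneg (by linarith) hε.le)
    rw [le_div_iff₀ hε] at h1
    rw [div_lt_iff₀ hε] at h2
    have h4 := mul_nonneg hε.le h3
    refine ⟨-⌊-θ / ε⌋, ?_, ?_⟩
    · push_cast
      nlinarith
    · push_cast
      nlinarith

/-- Parseval's identity for the trigonometric expansion. -/
theorem hasSum_sq_of_hasSum_smul {c : TrigIndex d → ℝ} {f : L2 d}
    (h : HasSum (fun p => c p • trigLp p) f) : HasSum (fun p => c p ^ 2) (‖f‖ ^ 2) := by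
  have h1 : Tendsto (fun s : Finset (TrigIndex d) => ‖∑ p ∈ s, c p • trigLp p‖ ^ 2) atTop
      (𝓝 (‖f‖ ^ 2)) := (Filter.Tendsto.norm h).pow 2
  refine h1.congr fun s => ?_
  rw [← real_inner_self_eq_norm_sq, orthonormal_trigLp.inner_sum]
  exact Finset.sum_congr rfl fun p _ => by simp [pow_two]

/-- The indices `(j, k)` with `j i ≤ M` for all `i`. -/
def trigBox (d M : ℕ) : Finset (TrigIndex d) :=
  ((Fintype.piFinset fun _ => Finset.range (M + 1)) ×ˢ Finset.univ).subtype _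

theorem mem_trigBox {M : ℕ} {p : TrigIndex d} : p ∈ trigBox d M ↔ ∀ i, p.1.1 i ≤ M := by
  simp [trigBox, Finset.mem_subtype]

theorem sum_trigBox_le (M : ℕ) (i₀ : Fin d) {F : ℕ → ℝ} (hF : ∀ j, 0 ≤ F j) :
    ∑ p ∈ trigBox d M, F (p.1.1 i₀)
      ≤ 2 ^ d * ((M + 1 : ℝ) ^ (d - 1) * ∑ j ∈ Finset.range (M + 1), F j) := by
  classical
  have h1 : ∑ p ∈ trigBox d M, F (p.1.1 i₀) ≤ ∑ x ∈ (Fintype.piFinset fun _ : Fin d =>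
      Finset.range (M + 1)) ×ˢ (Finset.univ : Finset (Fin d → Bool)), F (x.1 i₀) := by
    rw [trigBox, Finset.sum_subtype_eq_sum_filter
      (f := fun x : (Fin d → ℕ) × (Fin d → Bool) => F (x.1 i₀))]
    exact Finset.sum_le_sum_of_subset_of_nonneg (Finset.filter_subset _ _) fun _ _ _ => hF _
  have h2 : ∑ j ∈ Fintype.piFinset fun _ : Fin d => Finset.range (M + 1), F (j i₀)
      = (M + 1 : ℝ) ^ (d - 1) * ∑ j ∈ Finset.range (M + 1), F j := by
    have h3 := Finset.prod_univ_sum (fun _ : Fin d => Finset.range (M + 1))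
      (fun i j => if i = i₀ then F j else 1)
    simp only [Finset.prod_ite_eq', Finset.mem_univ, if_true] at h3
    rw [← h3, ← Finset.prod_erase_mul _ _ (Finset.mem_univ i₀)]
    simp only [if_true]
    congr 1
    rw [Finset.prod_congr rfl (g := fun _ => (M + 1 : ℝ)) fun i hi => by
      simp [(Finset.mem_erase.1 hi).1]]
    simp
  refine h1.trans (le_of_eq ?_)
  rw [Finset.sum_product]
  simp only [Finset.sum_const, Finset.card_univ, Fintype.card_pi, Fintype.card_bool,
    Finset.prod_const, Fintype.card_fin, nsmul_eq_mul, ← Finset.mul_sum]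
  rw [h2]
  push_cast
  ring

theorem card_trigBox_le (hd : 1 ≤ d) (M : ℕ) :
    ((trigBox d M).card : ℝ) ≤ 2 ^ d * (M + 1 : ℝ) ^ d := by
  have := sum_trigBox_le M (⟨0, hd⟩ : Fin d) (F := fun _ => 1) (fun _ => zero_le_one)
  simp only [Finset.sum_const, nsmul_eq_mul, mul_one, Finset.card_range] at this
  refine this.trans (le_of_eq ?_)
  push_cast
  rw [← pow_succ, Nat.sub_add_cancel hd]

theorem sum_inv_sqrt_le (M : ℕ) :
    ∑ j ∈ Finset.range (M + 1), (√(max (j : ℝ) 1))⁻¹ ≤ 1 + 2 * √(M : ℝ) := by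
  induction M with
  | zero => simp
  | succ M ih =>
    rw [Finset.sum_range_succ]
    have h0 : (0 : ℝ) ≤ M := Nat.cast_nonneg M
    have h1 : max (((M + 1 : ℕ) : ℝ)) 1 = M + 1 := by push_cast; exact max_eq_left (by linarith)
    rw [h1]
    push_cast
    have ha := Real.sq_sqrt h0
    have hb := Real.sq_sqrt (by linarith : (0 : ℝ) ≤ M + 1)
    have hb0 : 0 < √((M : ℝ) + 1) := by positivity
    have h2 : (√((M : ℝ) + 1))⁻¹ ≤ 2 * (√((M : ℝ) + 1) - √(M : ℝ)) := by
      rw [inv_le_iff_one_le_mul₀ hb0]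
      nlinarith [sq_nonneg (√((M : ℝ) + 1) - √(M : ℝ))]
    linarith

/-- The sum of `(M / max (j i₀) 1) ^ (1 / 2)` over the box is of the order of its cardinality. -/
theorem sum_trigBox_sqrt_le {M : ℕ} (i₀ : Fin d) (hM : (1 : ℝ) ≤ M) :
    ∑ p ∈ trigBox d M, √(M : ℝ) * (√(max (p.1.1 i₀ : ℝ) 1))⁻¹ ≤ 3 * 4 ^ d * (M : ℝ) ^ d := by
  have hd : 1 ≤ d := i₀.pos
  have hsq : √(M : ℝ) * √(M : ℝ) = M := Real.mul_self_sqrt (by linarith)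
  have hsq1 : 1 ≤ √(M : ℝ) := Real.one_le_sqrt.2 hM
  have h1 := sum_trigBox_le M i₀ (F := fun j => (√(max (j : ℝ) 1))⁻¹) fun j => by positivity
  have h2 := sum_inv_sqrt_le M
  calc ∑ p ∈ trigBox d M, √(M : ℝ) * (√(max (p.1.1 i₀ : ℝ) 1))⁻¹
      ≤ √(M : ℝ) * (2 ^ d * ((M + 1 : ℝ) ^ (d - 1) * (3 * √(M : ℝ)))) := by
        rw [← Finset.mul_sum]
        refine mul_le_mul_of_nonneg_left (h1.trans ?_) (by positivity)
        gcongr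
        linarith
    _ ≤ √(M : ℝ) * (2 ^ d * ((2 * M : ℝ) ^ (d - 1) * (3 * √(M : ℝ)))) := by
        have : (M + 1 : ℝ) ≤ 2 * M := by linarith
        gcongr
    _ = 3 * (2 ^ d * 2 ^ (d - 1)) * ((M : ℝ) ^ (d - 1) * (√(M : ℝ) * √(M : ℝ))) := by
        rw [mul_pow]
        ring
    _ ≤ 3 * (2 ^ d * 2 ^ d) * ((M : ℝ) ^ (d - 1) * M) := by
        rw [hsq]
        gcongr
        · norm_num
        · exact Nat.sub_le d 1
    _ = _ := by
        rw [← mul_pow, ← pow_succ, Nat.sub_add_cancel hd]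
        norm_num

/-- A crude bound for the logarithms that make up the entropy: any power of `y` with exponent
less than `1` would do on the right hand side. -/
theorem log_one_add_mul_rpow_le {s b y : ℝ} (hs : 0 < s) (hb : 0 < b) (hy : 1 ≤ y) :
    Real.log (1 + b * y ^ (2 * s)) ≤ 4 * s * (1 + b) ^ (1 / (4 * s)) * √y := by
  have hy0 : 0 ≤ y := by linarith
  have h1 : (1 : ℝ) ≤ y ^ (2 * s) := Real.one_le_rpow hy (by positivity)
  have h2 : 1 + b * y ^ (2 * s) ≤ (1 + b) * y ^ (2 * s) := by nlinarith
  calc Real.log (1 + b * y ^ (2 * s)) ≤ Real.log ((1 + b) * y ^ (2 * s)) :=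
        Real.log_le_log (by positivity) h2
    _ ≤ ((1 + b) * y ^ (2 * s)) ^ (1 / (4 * s)) / (1 / (4 * s)) :=
        Real.log_le_rpow_div (by positivity) (by positivity)
    _ = _ := by
        rw [Real.mul_rpow (by positivity) (by positivity), ← Real.rpow_mul hy0, Real.sqrt_eq_rpow]
        have : 2 * s * (1 / (4 * s)) = 1 / 2 := by field_simp; norm_num
        rw [this]
        field_simp

theorem natCast_le_size (p : TrigIndex d) (i : Fin d) : (p.1.1 i : ℝ) ≤ p.size :=
  Finset.single_le_sum (f := fun i => (p.1.1 i : ℝ)) (fun _ _ => Nat.cast_nonneg _)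
    (Finset.mem_univ i)

theorem one_le_size {p : TrigIndex d} (hp : p.size ≠ 0) : 1 ≤ p.size := by
  have h : p.size = ((∑ i, p.1.1 i : ℕ) : ℝ) := by simp [TrigIndex.size]
  rw [h] at hp ⊢
  exact_mod_cast Nat.one_le_iff_ne_zero.2 (by exact_mod_cast hp)

theorem eq_of_size_eq_zero {p p' : TrigIndex d} (hp : p.size = 0) (hp' : p'.size = 0) :
    p = p' := by
  have h (p : TrigIndex d) (hp : p.size = 0) (i : Fin d) : p.1.1 i = 0 := by
    have := natCast_le_size p i
    rw [hp] at this
    exact_mod_cast le_antisymm this (Nat.cast_nonneg _)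
  refine Subtype.ext (Prod.ext (funext fun i => ?_) (funext fun i => ?_))
  · rw [h p hp, h p' hp']
  · rw [p.2 i (h p hp i), p'.2 i (h p' hp' i)]

theorem zero_mem_ellipsoidClass (α : TrigIndex d → ℝ) (L : ℝ) :
    (0 : L2 d) ∈ ellipsoidClass α L :=
  ⟨0, ⟨by simp, by simp [sq_nonneg]⟩, by simp⟩

/-- The net: the trigonometric polynomials in the ellipsoid whose coefficients are multiples of a
small `ε`. It covers the ellipsoid up to the rounding error and the truncation error. The parameter
`t` is the one of the exponential Chebyshev bound. -/
theorem exists_net {α : TrigIndex d → ℝ} (hα : ∀ p, 0 < α p) {L : ℝ}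
    (T : Finset (TrigIndex d)) {ρ : ℝ} (hρ0 : 0 ≤ ρ) (hρ : ∀ p ∉ T, 1 ≤ ρ * α p ^ 2)
    {ε t : ℝ} (hε : 0 < ε) (ht : 0 < t) :
    ∃ N : Finset (L2 d), (∀ f ∈ ellipsoidClass α L, ∃ g ∈ N,
        ‖f - g‖ ^ 2 ≤ T.card * ε ^ 2 + ρ * L ^ 2) ∧
      (∀ g ∈ N, g ∈ Submodule.span ℝ (trigLp '' (T : Set (TrigIndex d)))) ∧
      (N.card : ℝ) ≤ Real.exp (t * L ^ 2) * ∏ p : T, (1 + 2 / (t * (α p ^ 2 * ε ^ 2))) := by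
  classical
  set w : T → ℝ := fun p => α p ^ 2 * ε ^ 2 with hw_def
  have hw (p : T) : 0 < w p := by have := hα p; positivity
  set S := (Fintype.piFinset fun p : T =>
    Finset.Icc (-(⌈L ^ 2 / w p⌉₊ : ℤ)) ⌈L ^ 2 / w p⌉₊).filter
      fun z => ∑ p, w p * (z p : ℝ) ^ 2 ≤ L ^ 2 with hS
  refine ⟨S.image fun z => ∑ p : T, (ε * (z p : ℝ)) • trigLp (p : TrigIndex d), ?_, ?_, ?_⟩
  · rintro f ⟨θ, ⟨hsum, hle⟩, hf⟩
    choose z hz1 hz2 using fun p => exists_round hε (θ p)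
    have hzS : (fun p : T => z p) ∈ S := by
      have hsumle : ∑ p : T, w p * (z p : ℝ) ^ 2 ≤ L ^ 2 := by
        calc ∑ p : T, w p * (z p : ℝ) ^ 2 ≤ ∑ p : T, α p ^ 2 * θ p ^ 2 := by
              refine Finset.sum_le_sum fun p _ => ?_
              have := mul_le_mul_of_nonneg_left (hz2 p) (sq_nonneg (α p))
              rw [hw_def]
              linarith
          _ = ∑ p ∈ T, α p ^ 2 * θ p ^ 2 :=
              Finset.sum_coe_sort T fun p => α p ^ 2 * θ p ^ 2
          _ ≤ ∑' p, α p ^ 2 * θ p ^ 2 := hsum.sum_le_tsum _ fun _ _ => by positivity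
          _ ≤ L ^ 2 := hle
      refine Finset.mem_filter.2 ⟨Fintype.mem_piFinset.2 fun p => ?_, hsumle⟩
      have h1 : w p * (z p : ℝ) ^ 2 ≤ L ^ 2 :=
        (Finset.single_le_sum (f := fun p : T => w p * (z p : ℝ) ^ 2)
          (fun p _ => mul_nonneg (hw p).le (sq_nonneg _)) (Finset.mem_univ p)).trans hsumle
      have h2 : (z p : ℝ) ^ 2 ≤ L ^ 2 / w p := by
        rw [le_div_iff₀ (hw p)]
        linarith
      have h3 : (z p) ^ 2 ≤ (⌈L ^ 2 / w p⌉₊ : ℤ) := by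
        exact_mod_cast h2.trans (Nat.le_ceil _)
      have h4 : |z p| ≤ (z p) ^ 2 := by
        rw [← sq_abs]
        exact Int.le_self_sq _
      exact Finset.mem_Icc.2 (abs_le.1 (h4.trans h3))
    refine ⟨_, Finset.mem_image_of_mem _ hzS, ?_⟩
    set g := ∑ p : T, (ε * (z p : ℝ)) • trigLp (p : TrigIndex d) with hg
    have hgs : HasSum (fun p => (if p ∈ T then ε * (z p : ℝ) else 0) • trigLp p) g := by
      have h1 : g = ∑ p ∈ T, (if p ∈ T then ε * (z p : ℝ) else 0) • trigLp p := by
        rw [hg, Finset.sum_coe_sort T fun p => (ε * (z p : ℝ)) • trigLp p]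
        exact Finset.sum_congr rfl fun p hp => by rw [if_pos hp]
      rw [h1]
      exact hasSum_sum_of_ne_finset_zero fun p hp => by rw [if_neg hp, zero_smul]
    have h1 := hf.sub hgs
    simp only [← sub_smul] at h1
    have h2 := hasSum_sq_of_hasSum_smul h1
    have h3 : HasSum (fun p => (if p ∈ T then ε ^ 2 else 0) + ρ * (α p ^ 2 * θ p ^ 2))
        (T.card * ε ^ 2 + ρ * ∑' p, α p ^ 2 * θ p ^ 2) := by
      refine HasSum.add ?_ (hsum.hasSum.mul_left ρ)
      have h4 : (T.card : ℝ) * ε ^ 2 = ∑ p ∈ T, if p ∈ T then ε ^ 2 else 0 := by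
        rw [← nsmul_eq_mul, ← Finset.sum_const]
        exact Finset.sum_congr rfl fun p hp => by rw [if_pos hp]
      rw [h4]
      exact hasSum_sum_of_ne_finset_zero fun p hp => by rw [if_neg hp]
    have h5 : ‖f - g‖ ^ 2 ≤ T.card * ε ^ 2 + ρ * ∑' p, α p ^ 2 * θ p ^ 2 := by
      refine hasSum_le (fun p => ?_) h2 h3
      by_cases hp : p ∈ T
      · simp only [hp, if_true]
        exact (hz1 p).trans (le_add_of_nonneg_right (by positivity))
      · simp only [hp, if_false, sub_zero, zero_add]
        rw [← mul_assoc]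
        exact le_mul_of_one_le_left (sq_nonneg _) (hρ p hp)
    exact h5.trans (by gcongr)
  · intro g hg
    obtain ⟨z, -, rfl⟩ := Finset.mem_image.1 hg
    exact Submodule.sum_mem _ fun p _ => Submodule.smul_mem _ _
      (Submodule.subset_span ⟨p, p.2, rfl⟩)
  · exact (Nat.cast_le.2 Finset.card_image_le).trans (card_lattice_ellipsoid_le hw _ ht _)

theorem log_le_of_le_exp_mul_prod {ι : Type*} [Fintype ι] {v : ι → ℝ} {c x : ℝ} (hc : 0 < c)
    (hv : ∀ p, 0 < v p) (h : c ≤ Real.exp x * ∏ p, v p) :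
    Real.log c ≤ x + ∑ p, Real.log (v p) := by
  refine (Real.log_le_log hc h).trans (le_of_eq ?_)
  rw [Real.log_mul (Real.exp_pos _).ne' (Finset.prod_pos fun p _ => hv p).ne', Real.log_exp,
    Real.log_prod fun p _ => (hv p).ne']

/-- The metric entropy of the ellipsoid is at most of the order `δ ^ (-d / s)`. -/
theorem exists_isPolynomialNet (hd : 1 ≤ d) {s L : ℝ} (hs : 0 < s) (hL : 0 < L)
    {α : TrigIndex d → ℝ} {C₀ : ℝ} (hC₀ : 0 < C₀)
    (hα : ∀ p : TrigIndex d, p.size ≠ 0 → C₀ * p.size ^ s ≤ α p)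
    (hα_zero : ∀ p : TrigIndex d, p.size = 0 → 0 < α p) :
    ∃ K : ℝ, 0 < K ∧ ∀ δ : ℝ, 0 < δ → δ ≤ 1 → ∃ N : Finset (L2 d),
      IsPolynomialNet (ellipsoidClass α L) s K δ N := by
  have hαpos (p : TrigIndex d) : 0 < α p := by
    by_cases hp : p.size = 0
    · exact hα_zero p hp
    · have := one_le_size hp
      exact lt_of_lt_of_le (by positivity) (hα p hp)
  set i₀ : Fin d := ⟨0, hd⟩
  -- the lower bound `α p ^ 2 ≥ b * max (j i₀) 1 ^ (2 * s)`
  obtain ⟨b, hb, hbα⟩ : ∃ b : ℝ, 0 < b ∧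
      ∀ p : TrigIndex d, b * (max (p.1.1 i₀ : ℝ) 1) ^ (2 * s) ≤ α p ^ 2 := by
    set p₀ : TrigIndex d := ⟨(fun _ => 0, fun _ => false), fun _ _ => rfl⟩ with hp₀
    have hs₀ : p₀.size = 0 := by simp [TrigIndex.size, hp₀]
    refine ⟨min (C₀ ^ 2) (α p₀ ^ 2), lt_min (by positivity) (by have := hαpos p₀; positivity),
      fun p => ?_⟩
    by_cases hp : p.size = 0
    · have h1 : (p.1.1 i₀ : ℝ) ≤ 1 := (natCast_le_size p i₀).trans (by rw [hp]; exact zero_le_one)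
      rw [max_eq_right h1, Real.one_rpow, mul_one, eq_of_size_eq_zero hp hs₀]
      exact min_le_right _ _
    · have h1 : max (p.1.1 i₀ : ℝ) 1 ≤ p.size := max_le (natCast_le_size p i₀) (one_le_size hp)
      have h2 := one_le_size hp
      calc _ ≤ C₀ ^ 2 * p.size ^ (2 * s) := by
            gcongr
            exact min_le_left _ _
        _ = (C₀ * p.size ^ s) ^ 2 := by
            rw [mul_pow, ← Real.rpow_natCast (p.size ^ s), ← Real.rpow_mul (by linarith)]
            congr 2
            push_cast
            ring
        _ ≤ α p ^ 2 := by
            gcongr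
            exact hα p hp
  obtain ⟨A, hA⟩ : ∃ x : ℝ, x = 1 + (2 * L / C₀) ^ (1 / s) := ⟨_, rfl⟩
  have hA1 : 1 ≤ A := hA ▸ le_add_of_nonneg_right (by positivity)
  obtain ⟨E, hE⟩ : ∃ x : ℝ, x = 4 * s * (1 + 2 / b) ^ (1 / (4 * s)) := ⟨_, rfl⟩
  have hE0 : 0 < E := by rw [hE]; positivity
  obtain ⟨K', hK'⟩ : ∃ x : ℝ, x = (2 * 4 ^ d * L ^ 2 + 3 * 4 ^ d * E) * (2 * A) ^ d := ⟨_, rfl⟩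
  have hK'0 : 0 < K' := by rw [hK']; positivity
  refine ⟨2 * A + K', by positivity, fun δ hδ hδ1 => ?_⟩
  obtain ⟨X, hX⟩ : ∃ x, x = δ ^ (-(1 / s)) := ⟨_, rfl⟩
  have hX1 : 1 ≤ X := hX ▸ Real.one_le_rpow_of_pos_of_le_one_of_nonpos hδ hδ1 (by
    rw [neg_nonpos]; positivity)
  have hXs : X ^ s = δ⁻¹ := by
    rw [hX, ← Real.rpow_mul hδ.le, ← Real.rpow_neg_one]
    congr 1
    field_simp
  obtain ⟨M, hM⟩ : ∃ x, x = ⌈A * X⌉₊ := ⟨_, rfl⟩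
  have hAX : 1 ≤ A * X := one_le_mul_of_one_le_of_one_le hA1 hX1
  have hMl : A * X ≤ M := hM ▸ Nat.le_ceil _
  have hMu : (M : ℝ) ≤ 2 * (A * X) := by
    have := Nat.ceil_lt_add_one (by linarith : 0 ≤ A * X)
    rw [← hM] at this
    linarith
  have hM1 : (1 : ℝ) ≤ M := hAX.trans hMl
  have hXM : X ≤ M := le_trans (le_mul_of_one_le_left (by linarith) hA1) hMl
  obtain ⟨T, hT⟩ : ∃ x, x = trigBox d M := ⟨_, rfl⟩
  have hTM : ∀ p ∈ T, ∀ i, p.1.1 i ≤ M := fun p hp => mem_trigBox.1 (hT ▸ hp)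
  have hTpos : 0 < (T.card : ℝ) := by
    have : (⟨(fun _ => 0, fun _ => false), fun _ _ => rfl⟩ : TrigIndex d) ∈ T :=
      hT ▸ mem_trigBox.2 fun _ => Nat.zero_le _
    exact_mod_cast Finset.card_pos.2 ⟨_, this⟩
  have hTle : (T.card : ℝ) ≤ 4 ^ d * (M : ℝ) ^ d := by
    rw [hT]
    refine (card_trigBox_le hd M).trans ?_
    rw [← mul_pow, ← mul_pow]
    exact pow_le_pow_left₀ (by positivity) (by linarith) d
  -- outside the box the coefficients of the ellipsoid are small
  have hρ : ∀ p ∉ T, 1 ≤ (δ / (2 * L)) ^ 2 * α p ^ 2 := by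
    intro p hp
    rw [hT, mem_trigBox] at hp
    push Not at hp
    obtain ⟨i, hi⟩ := hp
    have h1 : (M : ℝ) ≤ p.size := le_trans (by exact_mod_cast hi.le) (natCast_le_size p i)
    have h2 : p.size ≠ 0 := by linarith
    have h3 : 2 * L / δ ≤ α p := by
      calc 2 * L / δ = C₀ * (((2 * L / C₀) ^ (1 / s)) ^ s * X ^ s) := by
            rw [← Real.rpow_mul (by positivity), one_div_mul_cancel hs.ne', Real.rpow_one, hXs]
            field_simp
        _ ≤ C₀ * (A ^ s * X ^ s) := by
            gcongr
            rw [hA]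
            linarith
        _ = C₀ * (A * X) ^ s := by rw [Real.mul_rpow (by linarith) (by linarith)]
        _ ≤ C₀ * p.size ^ s := by
            gcongr
            exact hMl.trans h1
        _ ≤ α p := hα p h2
    rw [← mul_pow]
    refine one_le_pow₀ ?_
    rw [div_le_iff₀ hδ] at h3
    rw [div_mul_eq_mul_div, one_le_div (by positivity)]
    linarith
  -- the rounding errors of all coefficients add up to at most `δ ^ 2 / 2`
  obtain ⟨ε, hε_def⟩ : ∃ x, x = δ / √(2 * T.card) := ⟨_, rfl⟩
  have hε : 0 < ε := by rw [hε_def]; positivity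
  have hε2 : T.card * ε ^ 2 = δ ^ 2 / 2 := by
    rw [hε_def, div_pow, Real.sq_sqrt (by positivity)]
    field_simp
  obtain ⟨N, hnet, hsupp, hcard⟩ := exists_net (L := L) hαpos T (sq_nonneg _) hρ hε
    (by positivity : 0 < 2 * (T.card : ℝ))
  have hNcard : 0 < (N.card : ℝ) := by
    obtain ⟨g, hg, -⟩ := hnet 0 (zero_mem_ellipsoidClass α L)
    exact_mod_cast Finset.card_pos.2 ⟨g, hg⟩
  refine ⟨N, fun f hf => ?_, fun g hg => ?_, ?_⟩
  · obtain ⟨g, hg, hfg⟩ := hnet f hf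
    refine ⟨g, hg, abs_le_of_sq_le_sq' (hfg.trans ?_) hδ.le |>.2⟩
    rw [hε2]
    have : (δ / (2 * L)) ^ 2 * L ^ 2 = δ ^ 2 / 4 := by
      field_simp
      norm_num
    rw [this]
    nlinarith [sq_nonneg δ]
  · refine Submodule.span_mono (Set.image_mono fun p hp i => ?_) (hsupp g hg)
    have h1 : (p.1.1 i : ℝ) ≤ M := by exact_mod_cast hTM p hp i
    rw [← hX]
    have h2 : 2 * (A * X) ≤ (2 * A + K') * X := by
      nlinarith [mul_pos hK'0 (by linarith : 0 < X)]
    linarith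
  · have hu (p : T) : 2 * (T.card : ℝ) * (α p ^ 2 * ε ^ 2) = α p ^ 2 * δ ^ 2 := by
      have : 2 * (T.card : ℝ) * (α p ^ 2 * ε ^ 2) = 2 * α p ^ 2 * (T.card * ε ^ 2) := by ring
      rw [this, hε2]
      ring
    -- `1 / δ ^ 2` is at most `M ^ (2 * s)`, so `α p ^ 2 * δ ^ 2 ≥ b * (max (j i₀) 1 / M) ^ (2 * s)`
    have hδM : 1 ≤ δ ^ 2 * (M : ℝ) ^ (2 * s) := by
      calc (1 : ℝ) = (δ * X ^ s) ^ 2 := by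
            rw [hXs, mul_inv_cancel₀ hδ.ne', one_pow]
        _ ≤ (δ * (M : ℝ) ^ s) ^ 2 := by gcongr
        _ = δ ^ 2 * (M : ℝ) ^ (2 * s) := by
            rw [mul_pow, ← Real.rpow_natCast ((M : ℝ) ^ s), ← Real.rpow_mul (by linarith)]
            congr 2
            push_cast
            ring
    have hterm (p : T) : Real.log (1 + 2 / (2 * (T.card : ℝ) * (α p ^ 2 * ε ^ 2)))
        ≤ E * (√(M : ℝ) * (√(max ((p : TrigIndex d).1.1 i₀ : ℝ) 1))⁻¹) := by
      have hαp := hαpos p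
      set m : ℝ := max ((p : TrigIndex d).1.1 i₀ : ℝ) 1 with hm
      have hm1 : 1 ≤ m := le_max_right _ _
      have hmM : m ≤ M := max_le (by exact_mod_cast hTM p p.2 i₀) hM1
      rw [hu]
      have h1 : 2 / (α p ^ 2 * δ ^ 2) ≤ 2 / b * (M / m : ℝ) ^ (2 * s) := by
        rw [Real.div_rpow (by linarith) (by linarith), div_mul_div_comm,
          div_le_div_iff₀ (by positivity) (by positivity)]
        have h2 := mul_le_mul (hbα p) hδM zero_le_one (sq_nonneg (α p))
        linarith
      calc _ ≤ Real.log (1 + 2 / b * (M / m : ℝ) ^ (2 * s)) :=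
            Real.log_le_log (by positivity) (by linarith)
        _ ≤ E * √(M / m : ℝ) := hE ▸ log_one_add_mul_rpow_le hs (by positivity)
            ((one_le_div (by linarith)).2 hmM)
        _ = _ := by rw [Real.sqrt_div (by linarith), div_eq_mul_inv]
    have hsum : ∑ p : T, Real.log (1 + 2 / (2 * (T.card : ℝ) * (α p ^ 2 * ε ^ 2)))
        ≤ 3 * 4 ^ d * E * (M : ℝ) ^ d := by
      calc _ ≤ ∑ p : T, E * (√(M : ℝ) * (√(max ((p : TrigIndex d).1.1 i₀ : ℝ) 1))⁻¹) :=
            Finset.sum_le_sum fun p _ => hterm p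
        _ = E * ∑ p ∈ T, √(M : ℝ) * (√(max (p.1.1 i₀ : ℝ) 1))⁻¹ := by
            rw [← Finset.mul_sum]
            congr 1
            exact Finset.sum_coe_sort T fun p => √(M : ℝ) * (√(max (p.1.1 i₀ : ℝ) 1))⁻¹
        _ ≤ E * (3 * 4 ^ d * (M : ℝ) ^ d) :=
            mul_le_mul_of_nonneg_left (hT ▸ sum_trigBox_sqrt_le i₀ hM1) hE0.le
        _ = _ := by ring
    have hMd : (M : ℝ) ^ d ≤ (2 * A) ^ d * δ ^ (-((d : ℝ) / s)) := by
      calc (M : ℝ) ^ d ≤ (2 * (A * X)) ^ d := by gcongr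
        _ = (2 * A) ^ d * X ^ (d : ℝ) := by rw [Real.rpow_natCast, ← mul_assoc, mul_pow]
        _ = _ := by
          rw [hX, ← Real.rpow_mul hδ.le]
          congr 2
          ring
    have hlog := log_le_of_le_exp_mul_prod hNcard (fun p : T => by
      have := hαpos p
      positivity) hcard
    calc Real.log N.card ≤ 2 * T.card * L ^ 2 + _ := hlog
      _ ≤ 2 * (4 ^ d * (M : ℝ) ^ d) * L ^ 2 + 3 * 4 ^ d * E * (M : ℝ) ^ d := by
          gcongr
      _ = (2 * 4 ^ d * L ^ 2 + 3 * 4 ^ d * E) * (M : ℝ) ^ d := by ring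
      _ ≤ (2 * 4 ^ d * L ^ 2 + 3 * 4 ^ d * E) * ((2 * A) ^ d * δ ^ (-((d : ℝ) / s))) := by
          gcongr
      _ = K' * δ ^ (-((d : ℝ) / s)) := by rw [hK']; ring
      _ ≤ (2 * A + K') * δ ^ (-((d : ℝ) / s)) := by
          gcongr
          linarith

end

/-! ### The lower bound -/

section

variable {d : ℕ} {Ω : Type*} {W : L2 d → Ω → ℝ}

theorem observation_eq {a : UnitAddTorus (Fin d) → ℝ} (ha : MemLp a 2 (torusMeasure d)) (n : ℕ)
    (f : L2 d) (ω : Ω) :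
    observation a W n f ω = fun h => inner ℝ (convLp a ha f) h + (√(n : ℝ))⁻¹ * W h ω := by
  ext h
  rw [observation, integral_periodicConv_mul ha]

variable [MeasurableSpace Ω] {P : Measure Ω}

/-- By symmetry of the Gaussian law. -/
theorem IsWhiteNoise.half_le_measure_nonneg (hW : IsWhiteNoise P W) [IsProbabilityMeasure P]
    (u : L2 d) : 2⁻¹ ≤ P {ω | 0 ≤ W u ω} := by
  set μ := gaussianReal 0 (‖u‖ ^ 2).toNNReal with hμ
  have h1 : P {ω | 0 ≤ W u ω} = μ (Set.Ici 0) := by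
    rw [hμ, ← hW.map_eq, Measure.map_apply (hW.measurable u) measurableSet_Ici]
    rfl
  have h2 : μ (Set.Iic 0) = μ (Set.Ici 0) := by
    have h3 := gaussianReal_map_neg (μ := 0) (v := (‖u‖ ^ 2).toNNReal)
    rw [neg_zero, ← hμ] at h3
    conv_rhs => rw [← h3, Measure.map_apply measurable_neg measurableSet_Ici]
    congr 1
    ext x
    simp
  have h4 : 1 ≤ μ (Set.Ici 0) + μ (Set.Ici 0) := by
    calc 1 = μ (Set.Ici 0 ∪ Set.Iic 0) := by
          rw [Set.union_comm, Set.Iic_union_Ici, measure_univ]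
      _ ≤ μ (Set.Ici 0) + μ (Set.Iic 0) := measure_union_le _ _
      _ = _ := by rw [h2]
  rw [h1]
  rw [← mul_two] at h4
  exact (ENNReal.inv_le_iff_le_mul (by simp) (by simp)).2 (by rwa [mul_comm])

/-- Le Cam's two point bound: no functional `ψ` of the observation is close to `b` under `f` and
close to `b'` under `f'` if the observations under `f` and `f'` are hard to distinguish. -/
theorem two_point_bound [IsProbabilityMeasure P] (hW : IsWhiteNoise P W)
    {a : UnitAddTorus (Fin d) → ℝ} (ha : MemLp a 2 (torusMeasure d)) {n : ℕ} (hn : 1 ≤ n)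
    (f f' : L2 d) {v : ℝ} (hv : n * ‖convLp a ha f' - convLp a ha f‖ ^ 2 ≤ v)
    {ψ : (L2 d → ℝ) → ℝ} (hψ : Measurable ψ) (b b' : ℝ) :
    ENNReal.ofReal ((b - b') ^ 2 * Real.exp (-(v / 2)) / 4)
      ≤ ∫⁻ ω, ENNReal.ofReal ((ψ (observation a W n f ω) - b) ^ 2) ∂P
        + ∫⁻ ω, ENNReal.ofReal ((ψ (observation a W n f' ω) - b') ^ 2) ∂P := by
  have hn0 : 0 < √(n : ℝ) := Real.sqrt_pos.2 (by exact_mod_cast hn)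
  set h₀ := convLp a ha f with hh₀
  set u : L2 d := √(n : ℝ) • (convLp a ha f' - h₀) with hu
  set G : (L2 d → ℝ) → (L2 d → ℝ) := fun y h => inner ℝ h₀ h + (√(n : ℝ))⁻¹ * y h with hG
  have hGm : Measurable G := measurable_pi_lambda _ fun h =>
    ((measurable_pi_apply h).const_mul _).const_add _
  have e0 (ω : Ω) : observation a W n f ω = G fun h => W h ω := observation_eq ha n f ω
  have e1 (ω : Ω) : observation a W n f' ω = G fun h => W h ω + inner ℝ u h := by
    rw [observation_eq ha n f' ω]
    ext h
    simp only [hG, hu, real_inner_smul_left, inner_sub_left]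
    field_simp
    ring
  have hu2 : ‖u‖ ^ 2 ≤ v := by
    rw [hu, norm_smul, mul_pow, Real.norm_eq_abs, sq_abs, Real.sq_sqrt (Nat.cast_nonneg n)]
    exact hv
  have hF (b : ℝ) : Measurable fun y => ENNReal.ofReal ((ψ (G y) - b) ^ 2) :=
    (((hψ.comp hGm).sub_const b).pow_const 2).ennreal_ofReal
  have mW : Measurable (fun ω (h : L2 d) => W h ω) :=
    measurable_pi_lambda _ fun h => hW.measurable h
  simp only [e0, e1]
  rw [hW.lintegral_add_inner u (hF b')]
  refine le_trans ?_ (le_of_eq (lintegral_add_left ((hF b).comp mW) _))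
  simp only [Function.comp_apply]
  set κ := ENNReal.ofReal ((b - b') ^ 2 * Real.exp (-(v / 2)) / 2) with hκ
  have hset : MeasurableSet {ω | 0 ≤ W u ω} := measurableSet_le measurable_const (hW.measurable u)
  calc ENNReal.ofReal ((b - b') ^ 2 * Real.exp (-(v / 2)) / 4)
      = κ * 2⁻¹ := by
        rw [hκ, ← ENNReal.ofReal_ofNat, ← ENNReal.ofReal_inv_of_pos two_pos,
          ← ENNReal.ofReal_mul (by positivity)]
        congr 1
        ring
    -- on the event `0 ≤ W u` the likelihood ratio is at least `exp (-v / 2)`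
    _ ≤ κ * P {ω | 0 ≤ W u ω} := by
        gcongr
        exact hW.half_le_measure_nonneg u
    _ = ∫⁻ ω in {ω | 0 ≤ W u ω}, κ ∂P := by rw [setLIntegral_const]
    _ ≤ ∫⁻ ω in {ω | 0 ≤ W u ω}, (ENNReal.ofReal ((ψ (G fun h => W h ω) - b) ^ 2)
          + ENNReal.ofReal (likelihood W u ω) *
            ENNReal.ofReal ((ψ (G fun h => W h ω) - b') ^ 2)) ∂P := by
        refine setLIntegral_mono' hset fun ω hω => ?_
        have hl0 : 0 ≤ likelihood W u ω := (Real.exp_pos _).le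
        rw [← ENNReal.ofReal_mul hl0, ← ENNReal.ofReal_add (sq_nonneg _)
          (mul_nonneg hl0 (sq_nonneg _))]
        refine ENNReal.ofReal_le_ofReal ?_
        have hω' : 0 ≤ W u ω := hω
        have hl : Real.exp (-(v / 2)) ≤ likelihood W u ω := by
          rw [likelihood, Real.exp_le_exp]
          linarith
        have hv1 : Real.exp (-(v / 2)) ≤ 1 := by
          rw [Real.exp_le_one_iff]
          linarith [sq_nonneg ‖u‖]
        set z := ψ (G fun h => W h ω)
        have h1 := mul_le_mul_of_nonneg_right hl (sq_nonneg (z - b'))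
        have h2 := mul_le_mul_of_nonneg_right hv1 (sq_nonneg (z - b))
        have h3 : (b - b') ^ 2 ≤ 2 * ((z - b) ^ 2 + (z - b') ^ 2) := by
          nlinarith [sq_nonneg (2 * z - b - b')]
        have h4 := mul_le_mul_of_nonneg_left h3 (Real.exp_pos (-(v / 2))).le
        linarith
    _ ≤ _ := setLIntegral_le_lintegral _ _

/-- **Assouad's lemma** for the hypercube of the functions `∑ η x • γ • φ x` with `η x ∈ {0, 1}`:
the risk is at least of the order `γ²` times the dimension if switching one coordinate changes the
law of the observation by a bounded amount. -/
theorem assouad_bound [IsProbabilityMeasure P] (hW : IsWhiteNoise P W)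
    {a : UnitAddTorus (Fin d) → ℝ} (ha : MemLp a 2 (torusMeasure d)) {n : ℕ} (hn : 1 ≤ n)
    {ι : Type*} [Fintype ι] {φ : ι → L2 d} (hφ : Orthonormal ℝ φ) {γ v : ℝ}
    (hv : ∀ x, n * (γ * ‖convLp a ha (φ x)‖) ^ 2 ≤ v) {F : Set (L2 d)}
    (hF : ∀ η : ι → Bool, ∑ x, (if η x then γ else 0) • φ x ∈ F)
    {ghat : (L2 d → ℝ) → L2 d} (hg : IsEstimator ghat) :
    ENNReal.ofReal (Fintype.card ι * (γ ^ 2 * Real.exp (-(v / 2)) / 8))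
      ≤ ⨆ f ∈ F, mise P a W n ghat f := by
  classical
  set f : (ι → Bool) → L2 d := fun η => ∑ x, (if η x then γ else 0) • φ x with hf
  set S := ⨆ f ∈ F, mise P a W n ghat f with hS
  set H : ι → (ι → Bool) → ℝ≥0∞ := fun x η => ∫⁻ ω, ENNReal.ofReal
    ((inner ℝ (φ x) (ghat (observation a W n (f η) ω)) - (if η x then γ else 0)) ^ 2) ∂P with hH
  have hψ (x : ι) : Measurable fun y => inner ℝ (φ x) (ghat y) :=
    (stronglyMeasurable_const.inner hg).measurable
  have hobs (η : ι → Bool) : Measurable fun ω => observation a W n (f η) ω :=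
    measurable_pi_lambda _ fun h => ((hW.measurable h).const_mul _).const_add _
  -- the risk dominates the sum of the coordinatewise risks
  have hbessel (η : ι → Bool) : ∑ x, H x η ≤ S := by
    refine le_trans ?_ (le_iSup₂ (f := fun f _ => mise P a W n ghat f) (f η) (hF η))
    refine (le_of_eq (lintegral_finsetSum _ fun x _ => ((((hψ x).comp (hobs η)).sub_const
      (if η x then γ else 0)).pow_const 2).ennreal_ofReal).symm).trans ?_
    simp only [Function.comp_apply]
    refine lintegral_mono fun ω => ?_
    rw [← ofReal_norm, ← ENNReal.ofReal_pow (norm_nonneg _),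
      ← ENNReal.ofReal_sum_of_nonneg fun _ _ => sq_nonneg _]
    refine ENNReal.ofReal_le_ofReal ?_
    refine le_trans (le_of_eq (Finset.sum_congr rfl fun x _ => ?_))
      (hφ.sum_inner_products_le (s := Finset.univ) (ghat (observation a W n (f η) ω) - f η))
    rw [inner_sub_right, hf, hφ.inner_right_fintype, Real.norm_eq_abs, sq_abs]
  -- pair the vertices that differ in the coordinate `x` only
  set flip : ι → (ι → Bool) → (ι → Bool) := fun x η => Function.update η x (!η x) with hflip
  have hflip2 (x : ι) : Function.Involutive (flip x) := by
    intro η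
    simp [hflip]
  have hpair (x : ι) (η : ι → Bool) :
      ENNReal.ofReal (γ ^ 2 * Real.exp (-(v / 2)) / 4) ≤ H x η + H x (flip x η) := by
    have e : f (flip x η) - f η = ((if η x then -γ else γ) : ℝ) • φ x := by
      rw [hf]
      simp only []
      rw [← Finset.sum_sub_distrib, Finset.sum_eq_single x]
      · rw [← sub_smul]
        cases h : η x <;> simp [hflip, h]
      · intro x' _ hx'
        simp [hflip, Function.update_of_ne hx']
      · simp
    have e2 : n * ‖convLp a ha (f (flip x η)) - convLp a ha (f η)‖ ^ 2 ≤ v := by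
      rw [← convLin_apply, ← convLin_apply, ← map_sub, e, map_smul, norm_smul, convLin_apply]
      refine le_trans (le_of_eq ?_) (hv x)
      rw [mul_pow, mul_pow, Real.norm_eq_abs, sq_abs]
      cases h : η x <;> simp
    refine le_trans (le_of_eq ?_) (two_point_bound hW ha hn (f η) (f (flip x η)) e2 (hψ x)
      (if η x then γ else 0) (if flip x η x then γ else 0))
    congr 3
    cases h : η x <;> simp [hflip, h]
  have hcube : (Fintype.card (ι → Bool) : ℝ≥0∞) * (Fintype.card ι *
      ENNReal.ofReal (γ ^ 2 * Real.exp (-(v / 2)) / 4)) ≤ Fintype.card (ι → Bool) * (2 * S) := by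
    calc (Fintype.card (ι → Bool) : ℝ≥0∞) * (Fintype.card ι *
          ENNReal.ofReal (γ ^ 2 * Real.exp (-(v / 2)) / 4))
        = ∑ x : ι, ∑ η : ι → Bool, ENNReal.ofReal (γ ^ 2 * Real.exp (-(v / 2)) / 4) := by
          simp only [Finset.sum_const, Finset.card_univ, nsmul_eq_mul]
          ring
      _ ≤ ∑ x : ι, ∑ η : ι → Bool, (H x η + H x (flip x η)) :=
          Finset.sum_le_sum fun x _ => Finset.sum_le_sum fun η _ => hpair x η
      _ = ∑ x : ι, 2 * ∑ η : ι → Bool, H x η := by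
          refine Finset.sum_congr rfl fun x _ => ?_
          have := Equiv.sum_comp (hflip2 x).toPerm (H x)
          rw [Function.Involutive.coe_toPerm] at this
          rw [Finset.sum_add_distrib, two_mul, this]
      _ = 2 * ∑ η : ι → Bool, ∑ x : ι, H x η := by
          rw [← Finset.mul_sum, Finset.sum_comm]
      _ ≤ 2 * ∑ η : ι → Bool, S := by
          gcongr with η
          exact hbessel η
      _ = _ := by
          simp only [Finset.sum_const, Finset.card_univ, nsmul_eq_mul]
          ring
  rw [ENNReal.mul_le_mul_iff_right (by simp) (by simp)] at hcube
  have h8 : ENNReal.ofReal (Fintype.card ι * (γ ^ 2 * Real.exp (-(v / 2)) / 8)) * 2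
      = Fintype.card ι * ENNReal.ofReal (γ ^ 2 * Real.exp (-(v / 2)) / 4) := by
    rw [← ENNReal.ofReal_natCast, ← ENNReal.ofReal_mul (Nat.cast_nonneg _),
      ← ENNReal.ofReal_ofNat, ← ENNReal.ofReal_mul (by positivity)]
    congr 1
    ring
  rw [← h8, mul_comm] at hcube
  exact (ENNReal.mul_le_mul_iff_right (by simp) (by simp)).1 hcube

/-- The cosine with frequencies `M + x i`, `x ∈ {0, …, M - 1}^d`. -/
def cosIndex {M : ℕ} (x : Fin d → Fin M) : TrigIndex d :=
  ⟨(fun i => M + x i, fun _ => false), fun _ _ => rfl⟩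

theorem cosIndex_injective {M : ℕ} :
    Function.Injective (cosIndex (d := d) (M := M)) := by
  intro x y h
  ext i
  have : M + (x i : ℕ) = M + (y i : ℕ) := congrFun (congrArg (fun p => p.1.1) h) i
  omega

theorem le_size_cosIndex (hd : 1 ≤ d) {M : ℕ} (x : Fin d → Fin M) :
    (M : ℝ) ≤ (cosIndex x).size := by
  refine le_trans ?_ (natCast_le_size (cosIndex x) ⟨0, hd⟩)
  simp [cosIndex]

theorem size_cosIndex_le {M : ℕ} (x : Fin d → Fin M) :
    (cosIndex x).size ≤ 2 * d * M := by
  refine (Finset.sum_le_card_nsmul _ _ (2 * M : ℝ) fun i _ => ?_).trans (le_of_eq ?_)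
  · simp only [cosIndex]
    have := (x i).2
    exact_mod_cast (by omega : M + (x i : ℕ) ≤ 2 * M)
  · simp
    ring

/-- All Fourier frequencies of `φ_{jk}` have the modulus `|j|`. -/
theorem norm_convLp_trigLp_le {q : ℝ} (hq : 0 ≤ q) {a : UnitAddTorus (Fin d) → ℝ}
    (ha : MemLp a 2 (torusMeasure d)) {C₃ : ℝ} (hC₃ : 0 < C₃)
    (hb : ∀ m : Fin d → ℤ, m ≠ 0 → ‖fc a m‖ ≤ C₃ * freqSize m ^ (-q)) {p : TrigIndex d} {M : ℝ}
    (hM : 0 < M) (hp : M ≤ p.size) : ‖convLp a ha (trigLp p)‖ ≤ C₃ * M ^ (-q) := by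
  have h1 : trigLp p ∈ bandlimited {m : Fin d → ℤ | ∀ i, (m i).natAbs = p.1.1 i} := by
    intro m hm
    simp only [Set.mem_ofPred_eq, not_forall] at hm
    obtain ⟨i, hi⟩ := hm
    exact fc_trigLp_eq_zero hi
  have h2 := norm_convLp_le ha (κ := C₃ * M ^ (-q)) (by positivity) (fun m hm => ?_) h1
  · rwa [orthonormal_trigLp.1 p, mul_one] at h2
  · have h3 : freqSize m = p.size := by
      refine Finset.sum_congr rfl fun i _ => ?_
      rw [← hm i, Nat.cast_natAbs, Int.cast_abs]
    have h4 : m ≠ 0 := by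
      rintro rfl
      simp only [freqSize, Pi.zero_apply, Int.cast_zero, abs_zero, Finset.sum_const_zero] at h3
      linarith
    refine (hb m h4).trans ?_
    rw [h3]
    exact mul_le_mul_of_nonneg_left
      (Real.rpow_le_rpow_of_nonpos hM hp (neg_nonpos.2 hq)) hC₃.le

theorem sum_smul_trigLp_mem_ellipsoidClass {α : TrigIndex d → ℝ} {L : ℝ} {ι : Type*} [Fintype ι]
    {e : ι → TrigIndex d} (he : Function.Injective e) (c : ι → ℝ)
    (h : ∑ x, α (e x) ^ 2 * c x ^ 2 ≤ L ^ 2) :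
    ∑ x, c x • trigLp (e x) ∈ ellipsoidClass α L := by
  have h0 (p) (hp : p ∉ Set.range e) : Function.extend e c 0 p = 0 :=
    Function.extend_apply' _ _ _ hp
  have h1 : HasSum (fun p => α p ^ 2 * Function.extend e c 0 p ^ 2)
      (∑ x, α (e x) ^ 2 * c x ^ 2) := by
    rw [← he.hasSum_iff fun p hp => by rw [h0 p hp]; simp]
    simp only [Function.comp_def, he.extend_apply]
    exact hasSum_fintype _
  refine ⟨Function.extend e c 0, ⟨h1.summable, h1.tsum_eq ▸ h⟩, ?_⟩
  rw [← he.hasSum_iff fun p hp => by rw [h0 p hp, zero_smul]]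
  simp only [Function.comp_def, he.extend_apply]
  exact hasSum_fintype _

/-- No estimator improves on the rate `n ^ (-2s / (2s + 2q + d))`. -/
theorem liminf_mise_pos (hd : 1 ≤ d) {s q L : ℝ} (hs : 0 < s) (hq : 0 ≤ q) (hL : 0 < L)
    {α : TrigIndex d → ℝ} {C₁ : ℝ} (hC₁ : 0 < C₁)
    (hα : ∀ p : TrigIndex d, p.size ≠ 0 → 0 ≤ α p ∧ α p ≤ C₁ * p.size ^ s)
    {a : UnitAddTorus (Fin d) → ℝ} (ha : MemLp a 2 (torusMeasure d)) {C₃ : ℝ} (hC₃ : 0 < C₃)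
    (hb : ∀ m : Fin d → ℤ, m ≠ 0 → ‖fc a m‖ ≤ C₃ * freqSize m ^ (-q))
    [IsProbabilityMeasure P] (hW : IsWhiteNoise P W) :
    0 < liminf (fun n : ℕ => ENNReal.ofReal ((n : ℝ) ^ (2 * s / (2 * s + 2 * q + d))) *
        ⨅ (ghat : (L2 d → ℝ) → L2 d) (_ : IsEstimator ghat),
          ⨆ f ∈ ellipsoidClass α L, mise P a W n ghat f) atTop := by
  have hd0 : (0 : ℝ) < d := by exact_mod_cast hd
  obtain ⟨r, hr_def⟩ : ∃ r, r = 2 * s + 2 * q + d := ⟨_, rfl⟩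
  have hr : 0 < r := by rw [hr_def]; positivity
  rw [← hr_def]
  obtain ⟨v, hv_def⟩ : ∃ v, v = L ^ 2 * C₃ ^ 2 / (C₁ * (2 * d : ℝ) ^ s) ^ 2 := ⟨_, rfl⟩
  obtain ⟨ρ, hρ_def⟩ : ∃ ρ, ρ = L ^ 2 / (C₁ * (4 * d : ℝ) ^ s) ^ 2 * (Real.exp (-(v / 2)) / 8) :=
    ⟨_, rfl⟩
  have hρ : 0 < ρ := by rw [hρ_def]; positivity
  refine lt_of_lt_of_le (ENNReal.ofReal_pos.2 hρ) (le_liminf_of_le (by isBoundedDefault) ?_)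
  filter_upwards [eventually_ge_atTop 1] with n hn
  have hn1 : (1 : ℝ) ≤ n := by exact_mod_cast hn
  have hn0 : (0 : ℝ) < n := by linarith
  obtain ⟨X, hX⟩ : ∃ X : ℝ, X = (n : ℝ) ^ (1 / r) := ⟨_, rfl⟩
  have hX1 : 1 ≤ X := hX ▸ Real.one_le_rpow hn1 (by positivity)
  have hX0 : 0 < X := by linarith
  have hXr : X ^ r = n := by
    rw [hX, ← Real.rpow_mul hn0.le, one_div_mul_cancel hr.ne', Real.rpow_one]
  obtain ⟨M, hM⟩ : ∃ M, M = ⌈X⌉₊ := ⟨_, rfl⟩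
  have hMl : X ≤ M := hM ▸ Nat.le_ceil X
  have hMu : (M : ℝ) ≤ 2 * X := by
    have := Nat.ceil_lt_add_one hX0.le
    rw [← hM] at this
    linarith
  have hMpos : (0 : ℝ) < M := by linarith
  -- the largest cube that fits into the ellipsoid
  obtain ⟨D, hD⟩ : ∃ D : ℝ, D = Fintype.card (Fin d → Fin M) := ⟨_, rfl⟩
  have hDM : D = (M : ℝ) ^ (d : ℝ) := by
    rw [hD, Fintype.card_fun, Fintype.card_fin, Fintype.card_fin, Real.rpow_natCast]
    push_cast
    rfl
  have hD0 : 0 < D := by rw [hDM]; positivity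
  obtain ⟨b, hbdef⟩ : ∃ b : ℝ, b = C₁ * (2 * d * M : ℝ) ^ s := ⟨_, rfl⟩
  have hb0 : 0 < b := by rw [hbdef]; positivity
  obtain ⟨γ, hγ_def⟩ : ∃ γ : ℝ, γ = L / (b * √D) := ⟨_, rfl⟩
  have hγ2 : γ ^ 2 = L ^ 2 / (b ^ 2 * D) := by
    rw [hγ_def, div_pow, mul_pow, Real.sq_sqrt hD0.le]
  have hcube (η : (Fin d → Fin M) → Bool) :
      ∑ x, (if η x then γ else 0) • trigLp (cosIndex x) ∈ ellipsoidClass α L := by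
    refine sum_smul_trigLp_mem_ellipsoidClass cosIndex_injective _ ?_
    calc ∑ x, α (cosIndex x) ^ 2 * (if η x then γ else 0) ^ 2
        ≤ ∑ x : Fin d → Fin M, b ^ 2 * γ ^ 2 := by
          refine Finset.sum_le_sum fun x _ => ?_
          have h1 := le_size_cosIndex hd x
          obtain ⟨h2, h3⟩ := hα (cosIndex x) (by linarith)
          have h4 : α (cosIndex x) ≤ b := by
            refine h3.trans ?_
            rw [hbdef]
            have := size_cosIndex_le x
            have : 0 ≤ (cosIndex x).size := by linarith
            gcongr
          refine mul_le_mul (pow_le_pow_left₀ h2 h4 2) ?_ (sq_nonneg _) (sq_nonneg _)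
          split_ifs
          · exact le_rfl
          · simp [sq_nonneg]
      _ = D * (b ^ 2 * γ ^ 2) := by
          rw [Finset.sum_const, nsmul_eq_mul, hD, Finset.card_univ]
      _ = L ^ 2 := by
          rw [hγ2]
          field_simp
      _ ≤ L ^ 2 := le_rfl
  have hv (x : Fin d → Fin M) : n * (γ * ‖convLp a ha (trigLp (cosIndex x))‖) ^ 2 ≤ v := by
    have h1 := norm_convLp_trigLp_le hq ha hC₃ hb hMpos (le_size_cosIndex hd x)
    have h2 : ‖convLp a ha (trigLp (cosIndex x))‖ ^ 2 ≤ (C₃ * (M : ℝ) ^ (-q)) ^ 2 :=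
      pow_le_pow_left₀ (norm_nonneg _) h1 2
    have hMr : (n : ℝ) ≤ (M : ℝ) ^ d * ((M : ℝ) ^ s) ^ 2 * ((M : ℝ) ^ q) ^ 2 := by
      calc (n : ℝ) = X ^ r := hXr.symm
        _ ≤ (M : ℝ) ^ r := by gcongr
        _ = _ := by
          rw [← Real.rpow_natCast _ d, ← Real.rpow_natCast (_ ^ s), ← Real.rpow_natCast (_ ^ q),
            ← Real.rpow_mul hMpos.le, ← Real.rpow_mul hMpos.le, ← Real.rpow_add hMpos,
            ← Real.rpow_add hMpos, hr_def]
          congr 1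
          push_cast
          ring
    have hb2 : b = C₁ * (2 * d : ℝ) ^ s * (M : ℝ) ^ s := by
      rw [hbdef, Real.mul_rpow (by positivity) hMpos.le, mul_assoc]
    calc n * (γ * ‖convLp a ha (trigLp (cosIndex x))‖) ^ 2
        ≤ n * (γ ^ 2 * (C₃ * (M : ℝ) ^ (-q)) ^ 2) := by
          rw [mul_pow]
          gcongr
      _ = v * (n / ((M : ℝ) ^ d * ((M : ℝ) ^ s) ^ 2 * ((M : ℝ) ^ q) ^ 2)) := by
          rw [hγ2, hb2, hDM, hv_def, Real.rpow_neg hMpos.le, Real.rpow_natCast]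
          have : 0 < (M : ℝ) ^ q := by positivity
          have : 0 < (M : ℝ) ^ s := by positivity
          have : 0 < (2 * d : ℝ) ^ s := by positivity
          field_simp
      _ ≤ v * 1 := by
          have : 0 ≤ v := by rw [hv_def]; positivity
          refine mul_le_mul_of_nonneg_left ?_ this
          exact (div_le_one (by positivity)).2 hMr
      _ = v := mul_one v
  have hfinal : ρ ≤ (n : ℝ) ^ (2 * s / r) * (D * (γ ^ 2 * Real.exp (-(v / 2)) / 8)) := by
    have h1 : (n : ℝ) ^ (2 * s / r) = (X ^ s) ^ 2 := by
      rw [← Real.rpow_natCast (X ^ s), ← Real.rpow_mul hX0.le, hX, ← Real.rpow_mul hn0.le]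
      congr 1
      push_cast
      ring
    have h2 : b ≤ C₁ * (4 * d : ℝ) ^ s * X ^ s := by
      rw [hbdef, mul_assoc C₁, ← Real.mul_rpow (by positivity) hX0.le]
      gcongr C₁ * ?_ ^ s
      nlinarith
    have hXs : 0 < X ^ s := by positivity
    calc ρ = (X ^ s) ^ 2 * (L ^ 2 / (C₁ * (4 * d : ℝ) ^ s * X ^ s) ^ 2)
            * (Real.exp (-(v / 2)) / 8) := by
          rw [hρ_def]
          have : 0 < (4 * d : ℝ) ^ s := by positivity
          field_simp
      _ ≤ (X ^ s) ^ 2 * (L ^ 2 / b ^ 2) * (Real.exp (-(v / 2)) / 8) := by gcongr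
      _ = _ := by
          rw [h1, hγ2]
          field_simp
  calc ENNReal.ofReal ρ
      ≤ ENNReal.ofReal ((n : ℝ) ^ (2 * s / r) * (D * (γ ^ 2 * Real.exp (-(v / 2)) / 8))) :=
        ENNReal.ofReal_le_ofReal hfinal
    _ = ENNReal.ofReal ((n : ℝ) ^ (2 * s / r)) *
        ENNReal.ofReal (D * (γ ^ 2 * Real.exp (-(v / 2)) / 8)) :=
        ENNReal.ofReal_mul (by positivity)
    _ ≤ _ := by
        gcongr
        refine le_iInf₂ fun ghat hg => ?_
        rw [hD]
        exact assouad_bound hW ha hn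
          (orthonormal_trigLp.comp _ cosIndex_injective) hv hcube hg

end

end InverseProblem

end

/-! ### The minimax rate -/

theorem corollary1 {d : ℕ} (hd : 1 ≤ d) {s q L : ℝ} (hs : 0 < s) (hq : 0 ≤ q) (hL : 0 < L)
    -- the coefficients of the ellipsoid
    (α : InverseProblem.TrigIndex d → ℝ) {C₀ C₁ : ℝ} (hC₀ : 0 < C₀) (hC₁ : 0 < C₁)
    (hα : ∀ p : InverseProblem.TrigIndex d, p.size ≠ 0 →
      C₀ * p.size ^ s ≤ α p ∧ α p ≤ C₁ * p.size ^ s)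
    (hα_zero : ∀ p : InverseProblem.TrigIndex d, p.size = 0 → 0 < α p)
    -- the convolution filter
    (a : UnitAddTorus (Fin d) → ℝ) (ha : MemLp a 2 (InverseProblem.torusMeasure d))
    {C₂ C₃ : ℝ} (hC₂ : 0 < C₂) (hC₃ : 0 < C₃)
    (hb : ∀ m : Fin d → ℤ, m ≠ 0 →
      C₂ * InverseProblem.freqSize m ^ (-q)
          ≤ ‖UnitAddTorus.mFourierCoeff (fun x => (a x : ℂ)) m‖ ∧
        ‖UnitAddTorus.mFourierCoeff (fun x => (a x : ℂ)) m‖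
          ≤ C₃ * InverseProblem.freqSize m ^ (-q))
    (hb_zero : UnitAddTorus.mFourierCoeff (fun x => (a x : ℂ)) 0 ≠ 0)
    -- the white noise
    {Ω : Type*} [MeasurableSpace Ω] (P : Measure Ω) [IsProbabilityMeasure P]
    (W : InverseProblem.L2 d → Ω → ℝ) (hW : InverseProblem.IsWhiteNoise P W) :
    -- the nets and the estimators exist
    (∃ K : ℝ, 0 < K ∧ ∀ δ : ℝ, 0 < δ → δ ≤ 1 → ∃ N : Finset (InverseProblem.L2 d),
      InverseProblem.IsPolynomialNet (InverseProblem.ellipsoidClass α L) s K δ N ∧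
        ∃ fhat, InverseProblem.IsNetEstimator a N fhat) ∧
    -- upper bound for the net estimator
    (∀ (K c C : ℝ) (δ : ℕ → ℝ) (N : ℕ → Finset (InverseProblem.L2 d))
      (fhat : ℕ → (InverseProblem.L2 d → ℝ) → InverseProblem.L2 d),
      0 < K → 0 < c → 0 < C →
      (∀ n : ℕ, 1 ≤ n → c * (n : ℝ) ^ (-(s / (2 * s + 2 * q + d))) ≤ δ n ∧
        δ n ≤ C * (n : ℝ) ^ (-(s / (2 * s + 2 * q + d)))) →
      (∀ n : ℕ, 1 ≤ n →
        InverseProblem.IsPolynomialNet (InverseProblem.ellipsoidClass α L) s K (δ n) (N n)) →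
      (∀ n : ℕ, 1 ≤ n → InverseProblem.IsNetEstimator a (N n) (fhat n)) →
      limsup (fun n : ℕ => ENNReal.ofReal ((n : ℝ) ^ (2 * s / (2 * s + 2 * q + d))) *
        ⨆ f ∈ InverseProblem.ellipsoidClass α L, InverseProblem.mise P a W n (fhat n) f)
        atTop < ⊤) ∧
    -- lower bound for all estimators
    0 < liminf (fun n : ℕ => ENNReal.ofReal ((n : ℝ) ^ (2 * s / (2 * s + 2 * q + d))) *
        ⨅ (ghat : (InverseProblem.L2 d → ℝ) → InverseProblem.L2 d)
          (_ : InverseProblem.IsEstimator ghat),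
          ⨆ f ∈ InverseProblem.ellipsoidClass α L, InverseProblem.mise P a W n ghat f)
        atTop := by
  have hb_zero' : InverseProblem.fc a 0 ≠ 0 := hb_zero
  refine ⟨?_, ?_, ?_⟩
  · obtain ⟨K, hK, h⟩ := InverseProblem.exists_isPolynomialNet hd hs hL hC₀
      (fun p hp => (hα p hp).1) hα_zero
    refine ⟨K, hK, fun δ hδ hδ1 => ?_⟩
    obtain ⟨N, hN⟩ := h δ hδ hδ1
    obtain ⟨g, hg, -⟩ := hN.net 0 (InverseProblem.zero_mem_ellipsoidClass α L)
    exact ⟨N, hN, InverseProblem.exists_isNetEstimator a ⟨g, hg⟩⟩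
  · intro K c C δ N fhat hK hc hC hδ hN hf
    exact InverseProblem.limsup_mise_lt_top hs hq ha hC₂ (fun m hm => (hb m hm).1) hb_zero' hW
      hK hc hC hδ hN hf
  · refine InverseProblem.liminf_mise_pos hd hs hq hL hC₁ (fun p hp => ⟨?_, (hα p hp).2⟩) ha hC₃
      (fun m hm => (hb m hm).2) hW
    have := InverseProblem.one_le_size hp
    exact le_trans (by positivity) (hα p hp).1
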